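/- Let $0<\xi^-<\xi^0<\xi^+<1$, $\gamma^->0$, $\gamma^+>0$ and $\gamma^-+\gamma^+\le 1$. Let $f^-$ and $f^+$ be twice continuously differentiable on the closed rectangles $[0,\xi^0]\times[0,1]$ and $[\xi^0,1]\times[0,1]$ respectively, and let $\phi_0$ be twice continuously differentiable on $[0,1]$ with $\phi_0(0)=\phi_0(1)=0$. A regular solution is a continuous function $u$ on $[0,1]^2$ that is of class $C^2$ in $D^-=(0,\xi^0)\times(0,1)$ and in $D^+=(\xi^0,1)\times(0,1)$ and satisfies $\Delta u=f^-$ in $D^-$, $\Delta u=f^+$ in $D^+$, $u=0$ on the boundary of the square, and $$u(\xi^0,x_2)=\gamma^-u(\xi^-,x_2)+\gamma^+u(\xi^+,x_2)+\phi_0(x_2),\qquad 0<x_2<1 .$$ Then there is exactly one regular solution $u$. It is given by the following (absolutely convergent) series. For $k\ge1$ put $\omega_k=k\pi$, $f_k^\pm(s)=2\int_0^1 f^\pm(s,t)\sin(\omega_kt)\,dt$, $\phi_{0k}=2\int_0^1\phi_0(t)\sin(\omega_kt)\,dt$, $$J_k^-(x)=\frac1{\omega_k}\int_0^{x}\sinh(\omega_k(x-s))f_k^-(s)\,ds,\qquad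 J_k^+(x)=\frac1{\omega_k}\int_{\xi^0}^{x}\sinh(\omega_k(x-s))f_k^+(s)\,ds,$$ $$F_k=\gamma^-\frac{\sinh(\omega_k\xi^-)}{\sinh(\omega_k\xi^0)}J_k^-(\xi^0)+\gamma^+\frac{\sinh(\omega_k(\xi^+-\xi^0))}{\sinh(\omega_k(1-\xi^0))}J_k^+(1)-\gamma^-J_k^-(\xi^-)-\gamma^+J_k^+(\xi^+),$$ $$\Phi_k=\Big\{1-\gamma^-\frac{\sinh(\omega_k\xi^-)}{\sinh(\omega_k\xi^0)}-\gamma^+\frac{\sinh(\omega_k(1-\xi^+))}{\sinh(\omega_k(1-\xi^0))}\Big\}^{-1}(-F_k+\phi_{0k}).$$ Then, for $0\le x_2\le1$, $$u(x_1,x_2)=\sum_{k=1}^\infty\Big[\frac{(\Phi_k-J_k^-(\xi^0))\sinh(\omega_kx_1)}{\sinh(\omega_k\xi^0)}+J_k^-(x_1)\Big]\sin(\omega_kx_2),\qquad 0\le x_1\le\xi^0,$$ $$u(\xi^0,x_2)=\sum_{k=1}^\infty\Phi_k\sin(\omega_kx_2),$$ $$u(x_1,x_2)=\sum_{k=1}^\infty\Big[\frac{\Phi_k\sinh(\omega_k(1-x_1))-J_k^+(1)\sinh(\omega_k(x_1-\xi^0))}{\sinh(\omega_k(1-\xi^0))}+J_k^+(x_1)\Big]\sin(\omega_kx_2),\qquad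 \xi^0\le x_1\le1 .$$ -/

import Mathlib

open Set Real

noncomputable section

/-- The data of the nonlocal contact problem on the unit square: the abscissae `ξm`, `ξ0`, `ξp` of
the three vertical segments, the weights `γm`, `γp`, the right-hand sides `fm`, `fp` of Poisson's
equation left and right of the line `x₁ = ξ0`, and the function `φ0` of `x₂` on that line. -/
structure ContactData where
  ξm : ℝ
  ξ0 : ℝ
  ξp : ℝ
  γm : ℝ
  γp : ℝ
  fm : ℝ × ℝ → ℝ
  fp : ℝ × ℝ → ℝ
  φ0 : ℝ → ℝ

/-- The Laplacian `∂²u/∂x₁² + ∂²u/∂x₂²` at `x`. It is only used where `u` is of class `C²` on a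
neighbourhood of `x`. -/
def planeLaplacian (u : ℝ × ℝ → ℝ) (x : ℝ × ℝ) : ℝ :=
  iteratedDeriv 2 (fun s => u (s, x.2)) x.1 + iteratedDeriv 2 (fun t => u (x.1, t)) x.2

/-- The closed unit square. -/
def closedSquare : Set (ℝ × ℝ) := Icc 0 1 ×ˢ Icc 0 1

namespace ContactData

variable (P : ContactData)

/-- The open rectangle left of the contact line. -/
def Dm : Set (ℝ × ℝ) := Ioo 0 P.ξ0 ×ˢ Ioo 0 1

/-- The open rectangle right of the contact line. -/
def Dp : Set (ℝ × ℝ) := Ioo P.ξ0 1 ×ˢ Ioo 0 1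

/-- Regular (classical) solutions: functions continuous on the closed square, of class `C²` in each
of the two open rectangles, which satisfy Poisson's equation in each of them, vanish on the
boundary of the square and satisfy the nonlocal contact condition. Only the values of `u` on the
closed square matter. -/
structure IsRegularSolution (u : ℝ × ℝ → ℝ) : Prop where
  continuousOn : ContinuousOn u closedSquare
  contDiffOn_left : ContDiffOn ℝ 2 u P.Dm
  contDiffOn_right : ContDiffOn ℝ 2 u P.Dp
  poisson_left : ∀ x ∈ P.Dm, planeLaplacian u x = P.fm x
  poisson_right : ∀ x ∈ P.Dp, planeLaplacian u x = P.fp x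
  zero_bottom : ∀ x₁ ∈ Icc (0 : ℝ) 1, u (x₁, 0) = 0
  zero_top : ∀ x₁ ∈ Icc (0 : ℝ) 1, u (x₁, 1) = 0
  zero_left : ∀ x₂ ∈ Icc (0 : ℝ) 1, u (0, x₂) = 0
  zero_right : ∀ x₂ ∈ Icc (0 : ℝ) 1, u (1, x₂) = 0
  contact : ∀ x₂ ∈ Ioo (0 : ℝ) 1,
    u (P.ξ0, x₂) = P.γm * u (P.ξm, x₂) + P.γp * u (P.ξp, x₂) + P.φ0 x₂

/-- The frequency `kπ`. -/
def freq (k : ℕ) : ℝ := k * π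

/-- The `k`-th sine coefficient on `[0, 1]`. -/
def sineCoeff (g : ℝ → ℝ) (k : ℕ) : ℝ := 2 * ∫ t in (0 : ℝ)..1, g t * sin (freq k * t)

/-- The sine coefficients, in the variable `x₂`, of the left right-hand side. -/
def fmCoeff (k : ℕ) (s : ℝ) : ℝ := sineCoeff (fun t => P.fm (s, t)) k

/-- The sine coefficients, in the variable `x₂`, of the right right-hand side. -/
def fpCoeff (k : ℕ) (s : ℝ) : ℝ := sineCoeff (fun t => P.fp (s, t)) k

/-- The integral `(1/(kπ)) ∫₀ˣ sinh(kπ(x-s)) f_k⁻(s) ds`. -/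
def Jm (k : ℕ) (x : ℝ) : ℝ :=
  1 / freq k * ∫ s in (0 : ℝ)..x, sinh (freq k * (x - s)) * P.fmCoeff k s

/-- The integral `(1/(kπ)) ∫_{ξ⁰}ˣ sinh(kπ(x-s)) f_k⁺(s) ds`. -/
def Jp (k : ℕ) (x : ℝ) : ℝ :=
  1 / freq k * ∫ s in P.ξ0..x, sinh (freq k * (x - s)) * P.fpCoeff k s

/-- The left ratio `sinh(kπξ⁻) / sinh(kπξ⁰)`. -/
def rm (k : ℕ) : ℝ := sinh (freq k * P.ξm) / sinh (freq k * P.ξ0)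

/-- The right ratio `sinh(kπ(1-ξ⁺)) / sinh(kπ(1-ξ⁰))`. -/
def rp (k : ℕ) : ℝ := sinh (freq k * (1 - P.ξp)) / sinh (freq k * (1 - P.ξ0))

/-- The contribution `F_k` of the right-hand sides to the equation for `Φ_k`. -/
def F (k : ℕ) : ℝ :=
  P.γm * P.rm k * P.Jm k P.ξ0
    + P.γp * (sinh (freq k * (P.ξp - P.ξ0)) / sinh (freq k * (1 - P.ξ0))) * P.Jp k 1
    - (P.γm * P.Jm k P.ξm + P.γp * P.Jp k P.ξp)

/-- The sine coefficients `Φ_k` of the trace of the solution on the line `x₁ = ξ⁰`. -/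
def Φ (k : ℕ) : ℝ :=
  (1 - (P.γm * P.rm k + P.γp * P.rp k))⁻¹ * (-P.F k + sineCoeff P.φ0 k)

/-- The coefficient functions `a_k⁻` of the sine series on the left. -/
def am (k : ℕ) (x : ℝ) : ℝ :=
  (P.Φ k - P.Jm k P.ξ0) * sinh (freq k * x) / sinh (freq k * P.ξ0) + P.Jm k x

/-- The coefficient functions `a_k⁺` of the sine series on the right. -/
def ap (k : ℕ) (x : ℝ) : ℝ :=
  (P.Φ k * sinh (freq k * (1 - x)) - P.Jp k 1 * sinh (freq k * (x - P.ξ0)))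
    / sinh (freq k * (1 - P.ξ0)) + P.Jp k x

/-- `u` is, on the closed square, the sum of the explicit sine series
`∑_{k ≥ 1} a_k⁻(x₁) sin(kπx₂)` for `0 ≤ x₁ ≤ ξ⁰`, `∑_{k ≥ 1} Φ_k sin(kπx₂)` for `x₁ = ξ⁰` and
`∑_{k ≥ 1} a_k⁺(x₁) sin(kπx₂)` for `ξ⁰ ≤ x₁ ≤ 1`, all of them convergent. -/
structure IsSumOfSineSeries (u : ℝ × ℝ → ℝ) : Prop where
  left : ∀ x₁ ∈ Icc 0 P.ξ0, ∀ x₂ ∈ Icc (0 : ℝ) 1,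
    HasSum (fun k : ℕ => P.am (k + 1) x₁ * sin (freq (k + 1) * x₂)) (u (x₁, x₂))
  middle : ∀ x₂ ∈ Icc (0 : ℝ) 1,
    HasSum (fun k : ℕ => P.Φ (k + 1) * sin (freq (k + 1) * x₂)) (u (P.ξ0, x₂))
  right : ∀ x₁ ∈ Icc P.ξ0 1, ∀ x₂ ∈ Icc (0 : ℝ) 1,
    HasSum (fun k : ℕ => P.ap (k + 1) x₁ * sin (freq (k + 1) * x₂)) (u (x₁, x₂))

end ContactData

end

/-! Uniqueness is a maximum principle. The difference of two regular solutions is harmonic in each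
rectangle and zero on the outer boundary. If `M` is the maximum of its modulus on the contact line,
comparison with affine functions of `x₁` (`le_affine_of_planeLaplacian_eq_zero`) bounds it by `M x₁
/ ξ0` on the left and by `M (1 - x₁) / (1 - ξ0)` on the right. On the lines `ξm`, `ξp` these bounds
are strictly below `M` unless `M = 0`, and since the weights sum to at most `1` the contact
condition gives `M < M`.

For existence, separation of variables turns the problem into two-point problems `a'' = ω² a + f_k`,
and `Φ k` is determined by imposing the contact condition on each mode (`Φ_eq`). Convexity of `sinh`
(`sinh_div_sinh_le`) keeps the denominator of `Φ` away from zero uniformly in `k`. A comparison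
principle (`abs_le_of_second_deriv_eq`) bounds the particular solutions by a constant times `1 /
ω²`, so the `Φ k` are absolutely summable and the series converge uniformly up to the boundary.

Smoothness inside is the delicate point: `f` need not vanish at `x₂ = 0, 1`, so its sine
coefficients are in general only of order `1 / k`, too weak for differentiating twice term by term.
Subtracting the corrector `f(x₁,0) bottomProfile(x₂) + f(x₁,1) topProfile(x₂)` leaves a Poisson
problem whose right-hand side vanishes at `x₂ = 0, 1`, hence has coefficients of order `1 / k²`. In
the interior the boundary values of the modes are damped by `exp(-ωδ)`, so the remaining series is
of class `C²` (`exists_hasPlaneJetOn_of_bound`), and `hasSum_sineSeries` identifies its Laplacian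
(`exists_hasPlaneJetOn`). -/

/-! ### Maximum principle and uniqueness. -/

theorem deriv_deriv_nonpos_of_isLocalMax {f : ℝ → ℝ} {x : ℝ} (h : IsLocalMax f x)
    (hc : ContinuousAt f x) : deriv (deriv f) x ≤ 0 := by
  by_contra! hpos
  -- A maximum that is also a minimum makes `f` locally constant, so its second derivative is `0`.
  have hmin := isLocalMin_of_deriv_deriv_pos hpos h.deriv_eq_zero hc
  have heq : f =ᶠ[nhds x] fun _ => f x := by
    filter_upwards [h, hmin] with y h₁ h₂ using le_antisymm h₁ h₂
  have := heq.deriv.deriv_eq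
  simp at this
  linarith

theorem iteratedDeriv_two_eq (f : ℝ → ℝ) (x : ℝ) : iteratedDeriv 2 f x = deriv (deriv f) x := by
  rw [iteratedDeriv_succ, iteratedDeriv_one]

theorem planeLaplacian_nonpos_of_isLocalMax {w : ℝ × ℝ → ℝ} {x : ℝ × ℝ} (h : IsLocalMax w x)
    (hc : ContinuousAt w x) : planeLaplacian w x ≤ 0 := by
  have h₁ : ContinuousAt (fun s : ℝ => ((s, x.2) : ℝ × ℝ)) x.1 := by fun_prop
  have h₂ : ContinuousAt (fun t : ℝ => ((x.1, t) : ℝ × ℝ)) x.2 := by fun_prop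
  have m₁ : IsLocalMax (fun s => w (s, x.2)) x.1 := h₁.eventually h
  have m₂ : IsLocalMax (fun t => w (x.1, t)) x.2 := h₂.eventually h
  have c₁ : ContinuousAt (fun s => w (s, x.2)) x.1 :=
    ContinuousAt.comp (g := w) (f := fun s : ℝ => ((s, x.2) : ℝ × ℝ)) hc h₁
  have c₂ : ContinuousAt (fun t => w (x.1, t)) x.2 :=
    ContinuousAt.comp (g := w) (f := fun t : ℝ => ((x.1, t) : ℝ × ℝ)) hc h₂
  have := deriv_deriv_nonpos_of_isLocalMax m₁ c₁
  have := deriv_deriv_nonpos_of_isLocalMax m₂ c₂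
  rw [planeLaplacian, iteratedDeriv_two_eq, iteratedDeriv_two_eq]
  linarith

theorem contDiffAt_slice_fst {w : ℝ × ℝ → ℝ} {x : ℝ × ℝ} (h : ContDiffAt ℝ 2 w x) :
    ContDiffAt ℝ 2 (fun s => w (s, x.2)) x.1 :=
  ContDiffAt.comp (g := w) x.1 h (contDiffAt_id.prodMk contDiffAt_const)

theorem contDiffAt_slice_snd {w : ℝ × ℝ → ℝ} {x : ℝ × ℝ} (h : ContDiffAt ℝ 2 w x) :
    ContDiffAt ℝ 2 (fun t => w (x.1, t)) x.2 :=
  ContDiffAt.comp (g := w) x.2 h (contDiffAt_const.prodMk contDiffAt_id)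

theorem planeLaplacian_add {v w : ℝ × ℝ → ℝ} {x : ℝ × ℝ} (hv : ContDiffAt ℝ 2 v x)
    (hw : ContDiffAt ℝ 2 w x) :
    planeLaplacian (fun y => v y + w y) x = planeLaplacian v x + planeLaplacian w x := by
  have h₁ := iteratedDeriv_fun_add (contDiffAt_slice_fst hv) (contDiffAt_slice_fst hw)
  have h₂ := iteratedDeriv_fun_add (contDiffAt_slice_snd hv) (contDiffAt_slice_snd hw)
  simp only [planeLaplacian, h₁, h₂]
  ring

theorem planeLaplacian_neg (v : ℝ × ℝ → ℝ) (x : ℝ × ℝ) :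
    planeLaplacian (fun y => -v y) x = -planeLaplacian v x := by
  simp only [planeLaplacian, iteratedDeriv_fun_neg]
  ring

theorem planeLaplacian_congr {v w : ℝ × ℝ → ℝ} {x : ℝ × ℝ} (h : v =ᶠ[nhds x] w) :
    planeLaplacian v x = planeLaplacian w x := by
  have h₁ : ContinuousAt (fun s : ℝ => ((s, x.2) : ℝ × ℝ)) x.1 := by fun_prop
  have h₂ : ContinuousAt (fun t : ℝ => ((x.1, t) : ℝ × ℝ)) x.2 := by fun_prop
  have m₁ : (fun s => v (s, x.2)) =ᶠ[nhds x.1] fun s => w (s, x.2) := h₁.eventually h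
  have m₂ : (fun t => v (x.1, t)) =ᶠ[nhds x.2] fun t => w (x.1, t) := h₂.eventually h
  rw [planeLaplacian, planeLaplacian, m₁.iteratedDeriv_eq, m₂.iteratedDeriv_eq]

theorem planeLaplacian_quadratic (ε l c : ℝ) (x : ℝ × ℝ) :
    planeLaplacian (fun y => ε * y.1 ^ 2 + l * y.1 + c) x = 2 * ε := by
  have h₁ : deriv (fun s : ℝ => ε * s ^ 2 + l * s + c) = fun s => 2 * ε * s + l := by
    funext s
    have := (((hasDerivAt_pow 2 s).const_mul ε).add ((hasDerivAt_id s).const_mul l)).add_const c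
    refine (this.deriv.trans ?_)
    simp
    ring
  have h₂ : deriv (fun s : ℝ => 2 * ε * s + l) x.1 = 2 * ε := by
    simp
  simp only [planeLaplacian, iteratedDeriv_two_eq, h₁, h₂]
  simp

/-- The weak maximum principle for harmonic functions on a rectangle, compared with an affine
function of the first variable. -/
theorem le_affine_of_planeLaplacian_eq_zero {a b l c : ℝ} (ha : 0 ≤ a) (hb : b ≤ 1)
    {w : ℝ × ℝ → ℝ}
    (hc : ContinuousOn w (Icc a b ×ˢ Icc 0 1)) (hd : ContDiffOn ℝ 2 w (Ioo a b ×ˢ Ioo 0 1))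
    (hl : ∀ x ∈ Ioo a b ×ˢ Ioo (0 : ℝ) 1, planeLaplacian w x = 0)
    (hbd : ∀ x ∈ Icc a b ×ˢ Icc (0 : ℝ) 1, x ∉ Ioo a b ×ˢ Ioo (0 : ℝ) 1 → w x ≤ l * x.1 + c)
    {y : ℝ × ℝ} (hy : y ∈ Icc a b ×ˢ Icc (0 : ℝ) 1) : w y ≤ l * y.1 + c := by
  by_contra! hgap
  set ε := (w y - (l * y.1 + c)) / 2 with hε
  have hε0 : 0 < ε := by rw [hε]; linarith
  -- This is `w - (l x₁ + c) + ε (x₁² - 1)`. The quadratic term makes the Laplacian `2ε > 0`, is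
  -- nonpositive since `0 ≤ x₁ ≤ 1`, and costs at most `ε`, half of the gap at `y`.
  set v : ℝ × ℝ → ℝ := fun x => w x + (ε * x.1 ^ 2 + (-l) * x.1 + (-c - ε)) with hv
  have hvc : ContinuousOn v (Icc a b ×ˢ Icc 0 1) := hc.add (by fun_prop)
  obtain ⟨m, hm, hmax⟩ := (isCompact_Icc.prod isCompact_Icc).exists_isMaxOn ⟨y, hy⟩ hvc
  have hvy : 0 < v y := by
    have : 0 ≤ ε * y.1 ^ 2 := by positivity
    simp only [hv]
    linarith
  have hvm : 0 < v m := hvy.trans_le (hmax hy)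
  have hmin : m ∈ Ioo a b ×ˢ Ioo (0 : ℝ) 1 := by
    by_contra hm'
    have h₁ := hbd m hm hm'
    have h₂ : m.1 ^ 2 ≤ 1 := by
      have := hm.1.1
      have := hm.1.2
      nlinarith
    have h₃ : ε * m.1 ^ 2 ≤ ε := by nlinarith
    simp only [hv] at hvm
    linarith
  have hopen : IsOpen (Ioo a b ×ˢ Ioo (0 : ℝ) 1) := isOpen_Ioo.prod isOpen_Ioo
  have hnhds := hopen.mem_nhds hmin
  have hsub : Ioo a b ×ˢ Ioo (0 : ℝ) 1 ⊆ Icc a b ×ˢ Icc (0 : ℝ) 1 :=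
    prod_mono Ioo_subset_Icc_self Ioo_subset_Icc_self
  have hloc : IsLocalMax v m := by
    filter_upwards [hnhds] with z hz using hmax (hsub hz)
  have h₁ := planeLaplacian_nonpos_of_isLocalMax hloc
    (hvc.continuousAt (Filter.mem_of_superset hnhds hsub))
  have h₂ := planeLaplacian_add (hd.contDiffAt hnhds)
    (w := fun x => ε * x.1 ^ 2 + (-l) * x.1 + (-c - ε)) (x := m) (by fun_prop)
  rw [planeLaplacian_quadratic, hl m hmin] at h₂
  linarith

namespace ContactData

variable {P : ContactData}

/-- The contact condition bounds the difference on the middle line by a weighted mean of its values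
on two lines where the affine barriers are strictly smaller than its maximum `M` on the middle line.
Once `M = 0`, the same barriers give zero everywhere. -/
theorem IsRegularSolution.eqOn (hξm : 0 < P.ξm) (hξm0 : P.ξm < P.ξ0) (hξ0p : P.ξ0 < P.ξp)
    (hξp : P.ξp < 1) (hγm : 0 < P.γm) (hγp : 0 < P.γp) (hγ : P.γm + P.γp ≤ 1)
    {u v : ℝ × ℝ → ℝ} (hu : P.IsRegularSolution u) (hv : P.IsRegularSolution v) :
    EqOn v u closedSquare := by
  have h0 : 0 < P.ξ0 := hξm.trans hξm0
  have h1 : P.ξ0 < 1 := hξ0p.trans hξp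
  have hc : ContinuousOn (fun t => |v (P.ξ0, t) - u (P.ξ0, t)|) (Icc (0 : ℝ) 1) := by
    have : MapsTo (fun t : ℝ => ((P.ξ0, t) : ℝ × ℝ)) (Icc 0 1) closedSquare :=
      fun t ht => ⟨⟨h0.le, h1.le⟩, ht⟩
    have hi : ContinuousOn (fun t : ℝ => ((P.ξ0, t) : ℝ × ℝ)) (Icc 0 1) := by fun_prop
    exact ((hv.continuousOn.comp hi this).sub (hu.continuousOn.comp hi this)).abs
  obtain ⟨t₀, ht₀, hmax⟩ := isCompact_Icc.exists_isMaxOn ⟨0, by simp⟩ hc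
  set M := |v (P.ξ0, t₀) - u (P.ξ0, t₀)| with hM
  have hM0 : 0 ≤ M := abs_nonneg _
  have hle : ∀ t ∈ Icc (0 : ℝ) 1, |v (P.ξ0, t) - u (P.ξ0, t)| ≤ M := fun t ht => hmax ht
  -- One-sided, for arbitrary `p`, `q`: applied to `(v, u)` and `(u, v)` it bounds the absolute
  -- value.
  have key : ∀ p q : ℝ × ℝ → ℝ, P.IsRegularSolution p → P.IsRegularSolution q →
      (∀ t ∈ Icc (0 : ℝ) 1, p (P.ξ0, t) - q (P.ξ0, t) ≤ M) →
      (∀ x ∈ Icc 0 P.ξ0 ×ˢ Icc (0 : ℝ) 1, p x - q x ≤ M / P.ξ0 * x.1) ∧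
      (∀ x ∈ Icc P.ξ0 1 ×ˢ Icc (0 : ℝ) 1, p x - q x ≤ M / (1 - P.ξ0) * (1 - x.1)) := by
    intro p q hp hq hpq
    have h1' : 0 < 1 - P.ξ0 := by linarith
    constructor
    · intro x hx
      have hsub : Icc 0 P.ξ0 ×ˢ Icc (0 : ℝ) 1 ⊆ closedSquare :=
        prod_mono (Icc_subset_Icc le_rfl h1.le) le_rfl
      have := le_affine_of_planeLaplacian_eq_zero (a := 0) (b := P.ξ0) (l := M / P.ξ0) (c := 0)
        (w := fun x => p x + -q x) le_rfl h1.le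
        ((hp.continuousOn.mono hsub).add (hq.continuousOn.mono hsub).neg)
        (hp.contDiffOn_left.add hq.contDiffOn_left.neg) ?_ ?_ hx
      · linarith
      · intro y hy
        have hn := (isOpen_Ioo.prod isOpen_Ioo).mem_nhds hy
        rw [planeLaplacian_add (hp.contDiffOn_left.contDiffAt hn)
          (hq.contDiffOn_left.contDiffAt hn).neg, planeLaplacian_neg, hp.poisson_left y hy,
          hq.poisson_left y hy]
        ring
      · rintro ⟨y₁, y₂⟩ ⟨⟨hy₁, hy₁'⟩, ⟨hy₂, hy₂'⟩⟩ hyn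
        simp only at hy₁ hy₁' hy₂ hy₂' ⊢
        have hpos : 0 ≤ M / P.ξ0 * y₁ := by positivity
        rcases hy₁.eq_or_lt with rfl | hy₁
        · rw [hp.zero_left _ ⟨hy₂, hy₂'⟩, hq.zero_left _ ⟨hy₂, hy₂'⟩]; simp
        rcases hy₁'.eq_or_lt with rfl | hy₁'
        · have := hpq y₂ ⟨hy₂, hy₂'⟩
          rw [div_mul_cancel₀ _ h0.ne']
          linarith
        rcases hy₂.eq_or_lt with rfl | hy₂
        · rw [hp.zero_bottom _ ⟨hy₁.le, by linarith⟩, hq.zero_bottom _ ⟨hy₁.le, by linarith⟩]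
          linarith
        rcases hy₂'.eq_or_lt with rfl | hy₂'
        · rw [hp.zero_top _ ⟨hy₁.le, by linarith⟩, hq.zero_top _ ⟨hy₁.le, by linarith⟩]
          linarith
        exact absurd ⟨⟨hy₁, hy₁'⟩, ⟨hy₂, hy₂'⟩⟩ hyn
    · intro x hx
      have hsub : Icc P.ξ0 1 ×ˢ Icc (0 : ℝ) 1 ⊆ closedSquare :=
        prod_mono (Icc_subset_Icc h0.le le_rfl) le_rfl
      have := le_affine_of_planeLaplacian_eq_zero (a := P.ξ0) (b := 1) (l := -(M / (1 - P.ξ0)))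
        (c := M / (1 - P.ξ0)) (w := fun x => p x + -q x) h0.le le_rfl
        ((hp.continuousOn.mono hsub).add (hq.continuousOn.mono hsub).neg)
        (hp.contDiffOn_right.add hq.contDiffOn_right.neg) ?_ ?_ hx
      · linarith
      · intro y hy
        have hn := (isOpen_Ioo.prod isOpen_Ioo).mem_nhds hy
        rw [planeLaplacian_add (hp.contDiffOn_right.contDiffAt hn)
          (hq.contDiffOn_right.contDiffAt hn).neg, planeLaplacian_neg, hp.poisson_right y hy,
          hq.poisson_right y hy]
        ring
      · rintro ⟨y₁, y₂⟩ ⟨⟨hy₁, hy₁'⟩, ⟨hy₂, hy₂'⟩⟩ hyn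
        simp only at hy₁ hy₁' hy₂ hy₂' ⊢
        have hpos : 0 ≤ M / (1 - P.ξ0) * (1 - y₁) :=
          mul_nonneg (by positivity) (by linarith)
        rcases hy₁'.eq_or_lt with rfl | hy₁'
        · rw [hp.zero_right _ ⟨hy₂, hy₂'⟩, hq.zero_right _ ⟨hy₂, hy₂'⟩]; simp
        rcases hy₁.eq_or_lt with rfl | hy₁
        · have := hpq y₂ ⟨hy₂, hy₂'⟩
          have h3 : M / (1 - P.ξ0) * (1 - P.ξ0) = M := div_mul_cancel₀ _ h1'.ne'
          linarith
        rcases hy₂.eq_or_lt with rfl | hy₂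
        · rw [hp.zero_bottom _ ⟨by linarith, by linarith⟩,
            hq.zero_bottom _ ⟨by linarith, by linarith⟩]
          linarith
        rcases hy₂'.eq_or_lt with rfl | hy₂'
        · rw [hp.zero_top _ ⟨by linarith, by linarith⟩, hq.zero_top _ ⟨by linarith, by linarith⟩]
          linarith
        exact absurd ⟨⟨hy₁, hy₁'⟩, ⟨hy₂, hy₂'⟩⟩ hyn
  obtain ⟨l₁, r₁⟩ := key v u hv hu fun t ht => (le_abs_self _).trans (hle t ht)
  obtain ⟨l₂, r₂⟩ := key u v hu hv fun t ht => by
    have := (neg_abs_le (v (P.ξ0, t) - u (P.ξ0, t)))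
    have := hle t ht
    linarith
  have hMz : M = 0 := by
    by_contra hne
    have hMpos : 0 < M := lt_of_le_of_ne hM0 (Ne.symm hne)
    have hmem0 : P.ξ0 ∈ Icc (0 : ℝ) 1 := ⟨h0.le, h1.le⟩
    -- The contact condition is available only for `0 < x₂ < 1`; at the ends of the line the
    -- difference is zero.
    have ht : t₀ ∈ Ioo (0 : ℝ) 1 := by
      refine ⟨lt_of_le_of_ne ht₀.1 ?_, lt_of_le_of_ne ht₀.2 ?_⟩
      · rintro rfl
        exact hne (by rw [hM, hv.zero_bottom _ hmem0, hu.zero_bottom _ hmem0]; simp)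
      · rintro rfl
        exact hne (by rw [hM, hv.zero_top _ hmem0, hu.zero_top _ hmem0]; simp)
    have hL : (P.ξm, t₀) ∈ Icc 0 P.ξ0 ×ˢ Icc (0 : ℝ) 1 := ⟨⟨hξm.le, hξm0.le⟩, ht₀⟩
    have hR : (P.ξp, t₀) ∈ Icc P.ξ0 1 ×ˢ Icc (0 : ℝ) 1 := ⟨⟨hξ0p.le, hξp.le⟩, ht₀⟩
    have a₁ := l₁ _ hL
    have a₂ := l₂ _ hL
    have b₁ := r₁ _ hR
    have b₂ := r₂ _ hR
    simp only at a₁ a₂ b₁ b₂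
    have hm : M / P.ξ0 * P.ξm < M := by
      rw [div_mul_eq_mul_div, div_lt_iff₀ h0]; nlinarith
    have hp : M / (1 - P.ξ0) * (1 - P.ξp) < M := by
      rw [div_mul_eq_mul_div, div_lt_iff₀ (by linarith)]; nlinarith
    have cv := hv.contact t₀ ht
    have cu := hu.contact t₀ ht
    have hlt : |v (P.ξ0, t₀) - u (P.ξ0, t₀)| < M := by
      rw [cv, cu, abs_lt]
      constructor <;> nlinarith
    exact hlt.ne rfl
  rintro x ⟨hx₁, hx₂⟩
  rcases le_total x.1 P.ξ0 with h | h
  · have hx : x ∈ Icc 0 P.ξ0 ×ˢ Icc (0 : ℝ) 1 := ⟨⟨hx₁.1, h⟩, hx₂⟩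
    have a₁ := l₁ x hx
    have a₂ := l₂ x hx
    rw [hMz] at a₁ a₂
    simp only [zero_div, zero_mul] at a₁ a₂
    linarith
  · have hx : x ∈ Icc P.ξ0 1 ×ˢ Icc (0 : ℝ) 1 := ⟨⟨h, hx₁.2⟩, hx₂⟩
    have a₁ := r₁ x hx
    have a₂ := r₂ x hx
    rw [hMz] at a₁ a₂
    simp only [zero_div, zero_mul] at a₁ a₂
    linarith

end ContactData

/-! ### Sine coefficients and pointwise convergence of sine series. -/

namespace ContactData

theorem freq_succ_ge_one (k : ℕ) : 1 ≤ freq (k + 1) := by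
  have := pi_gt_three
  have : (0 : ℝ) ≤ k := k.cast_nonneg
  simp only [freq]
  push_cast
  nlinarith

theorem freq_succ_pos (k : ℕ) : 0 < freq (k + 1) := one_pos.trans_le (freq_succ_ge_one k)

theorem summable_inv_freq_sq : Summable fun k : ℕ => 1 / freq (k + 1) ^ 2 := by
  have h := (Real.summable_one_div_nat_pow.mpr one_lt_two).mul_left (1 / π ^ 2)
  refine ((summable_nat_add_iff 1).mpr h).congr fun k => ?_
  simp only [freq]
  field_simp

theorem sin_freq (k : ℕ) : sin (freq k) = 0 := sin_nat_mul_pi k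

theorem cos_freq (k : ℕ) : cos (freq k) = (-1) ^ k := cos_nat_mul_pi k

theorem intervalIntegrable_mul_sin {g : ℝ → ℝ} (hg : ContinuousOn g (Icc 0 1)) (k : ℕ) :
    IntervalIntegrable (fun t => g t * sin (freq k * t)) MeasureTheory.volume 0 1 := by
  refine ContinuousOn.intervalIntegrable ?_
  rw [uIcc_of_le zero_le_one]
  exact hg.mul (by fun_prop)

theorem sineCoeff_congr {g h : ℝ → ℝ} (k : ℕ) (hgh : EqOn g h (Icc 0 1)) :
    sineCoeff g k = sineCoeff h k := by
  simp only [sineCoeff]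
  congr 1
  refine intervalIntegral.integral_congr fun t ht => ?_
  rw [uIcc_of_le zero_le_one] at ht
  simp only [hgh ht]

theorem sineCoeff_add {g h : ℝ → ℝ} (k : ℕ) (hg : ContinuousOn g (Icc 0 1))
    (hh : ContinuousOn h (Icc 0 1)) :
    sineCoeff (fun t => g t + h t) k = sineCoeff g k + sineCoeff h k := by
  simp only [sineCoeff, add_mul]
  rw [intervalIntegral.integral_add (intervalIntegrable_mul_sin hg k)
    (intervalIntegrable_mul_sin hh k)]
  ring

theorem sineCoeff_const_mul (c : ℝ) (g : ℝ → ℝ) (k : ℕ) :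
    sineCoeff (fun t => c * g t) k = c * sineCoeff g k := by
  simp only [sineCoeff, mul_assoc]
  rw [intervalIntegral.integral_const_mul]
  ring

theorem abs_sineCoeff_le {g : ℝ → ℝ} {C : ℝ} (k : ℕ) (hC : ∀ t ∈ Icc (0 : ℝ) 1, |g t| ≤ C) :
    |sineCoeff g k| ≤ 2 * C := by
  have : ‖∫ t in (0 : ℝ)..1, g t * sin (freq k * t)‖ ≤ C * |1 - 0| := by
    refine intervalIntegral.norm_integral_le_of_norm_le_const fun t ht => ?_
    rw [uIoc_of_le zero_le_one] at ht
    have h₁ := hC t ⟨ht.1.le, ht.2⟩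
    have h₂ := abs_sin_le_one (freq k * t)
    rw [norm_mul, norm_eq_abs, norm_eq_abs]
    nlinarith [abs_nonneg (g t), abs_nonneg (sin (freq k * t))]
  rw [sineCoeff, abs_mul, abs_two]
  simp only [norm_eq_abs, sub_zero, abs_one, mul_one] at this
  linarith

/-- Two integrations by parts in a sine coefficient. -/
theorem sineCoeff_eq_of_hasDerivWithinAt {g g₁ g₂ : ℝ → ℝ}
    (hg : ∀ t ∈ Icc (0 : ℝ) 1, HasDerivWithinAt g (g₁ t) (Icc 0 1) t)
    (hg₁ : ∀ t ∈ Icc (0 : ℝ) 1, HasDerivWithinAt g₁ (g₂ t) (Icc 0 1) t)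
    (hg₂ : ContinuousOn g₂ (Icc 0 1)) (k : ℕ) :
    sineCoeff g (k + 1) = 2 * (g 0 - (-1) ^ (k + 1) * g 1) / freq (k + 1)
      - sineCoeff g₂ (k + 1) / freq (k + 1) ^ 2 := by
  set ω := freq (k + 1) with hω
  have hω0 : ω ≠ 0 := (freq_succ_pos k).ne'
  have c₁ : ContinuousOn g₁ (Icc 0 1) := fun t ht => (hg₁ t ht).continuousWithinAt
  have huIcc : uIcc (0 : ℝ) 1 = Icc 0 1 := uIcc_of_le zero_le_one
  have i₁ := intervalIntegral.integral_mul_deriv_eq_deriv_mul_of_hasDerivWithinAt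
    (a := 0) (b := 1) (u := g) (u' := g₁) (v := fun t => -cos (ω * t) / ω)
    (v' := fun t => sin (ω * t)) (by rwa [huIcc]) ?_
    (by rw [← huIcc] at c₁; exact c₁.intervalIntegrable)
    (Continuous.intervalIntegrable (by fun_prop) _ _)
  have i₂ := intervalIntegral.integral_mul_deriv_eq_deriv_mul_of_hasDerivWithinAt
    (a := 0) (b := 1) (u := g₁) (u' := g₂) (v := fun t => sin (ω * t) / ω)
    (v' := fun t => cos (ω * t)) (by rwa [huIcc]) ?_
    (by rw [← huIcc] at hg₂; exact hg₂.intervalIntegrable)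
    (Continuous.intervalIntegrable (by fun_prop) _ _)
  · have e₁ : ∫ t in (0 : ℝ)..1, g₁ t * (-cos (ω * t) / ω)
        = -(1 / ω) * ∫ t in (0 : ℝ)..1, g₁ t * cos (ω * t) := by
      rw [← intervalIntegral.integral_const_mul]
      congr 1; funext t; ring
    have e₂ : ∫ t in (0 : ℝ)..1, g₂ t * (sin (ω * t) / ω)
        = 1 / ω * ∫ t in (0 : ℝ)..1, g₂ t * sin (ω * t) := by
      rw [← intervalIntegral.integral_const_mul]
      congr 1; funext t; ring
    simp only [sineCoeff, ← hω]
    rw [i₁, e₁, i₂, e₂]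
    -- The boundary terms of the second integration by parts vanish because `sin ω = 0`; those of
    -- the first give the values of `g` at the ends.
    simp only [mul_one, mul_zero, cos_zero, sin_zero]
    rw [hω, sin_freq, cos_freq]
    rw [← hω]
    field_simp
    ring
  · intro t _
    have := ((hasDerivAt_id t).const_mul ω).sin.div_const ω
    refine (this.congr_deriv ?_).hasDerivWithinAt
    simp only [id, mul_one]
    field_simp
  · intro t _
    have := ((hasDerivAt_id t).const_mul ω).cos.neg.div_const ω
    refine (this.congr_deriv ?_).hasDerivWithinAt
    simp only [id, mul_one]
    field_simp

/-- A continuous function on `[0, 1]` which vanishes at the ends is the sum of its sine series if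
the sine coefficients are summable. -/
theorem hasSum_sineSeries {q : ℝ → ℝ} (hq : ContinuousOn q (Icc 0 1)) (h0 : q 0 = 0)
    (h1 : q 1 = 0) (hs : Summable fun k => sineCoeff q (k + 1)) {t : ℝ}
    (ht : t ∈ Icc (0 : ℝ) 1) :
    HasSum (fun k => sineCoeff q (k + 1) * sin (freq (k + 1) * t)) (q t) := by
  have : Fact ((0 : ℝ) < 2) := ⟨two_pos⟩
  -- The odd extension of `q` to `[-1, 1]`: continuous since `q 0 = 0`, and with matching ends for
  -- period `2` since `q 1 = 0`.
  set G : ℝ → ℂ := fun s => ((q (max s 0) - q (max (-s) 0) : ℝ) : ℂ) with hG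
  have hGc : ContinuousOn G (Icc (-1) (-1 + 2)) := by
    refine Complex.continuous_ofReal.comp_continuousOn (ContinuousOn.sub ?_ ?_)
    · refine hq.comp (by fun_prop) fun s hs => ⟨le_max_right _ _, max_le ?_ zero_le_one⟩
      linarith [hs.2]
    · refine hq.comp (by fun_prop) fun s hs => ⟨le_max_right _ _, max_le ?_ zero_le_one⟩
      linarith [hs.1]
  have hGper : G (-1) = G (-1 + 2) := by
    norm_num [hG, h0, h1]
  have hGpos : ∀ s, 0 ≤ s → G s = q s := by
    intro s hs
    simp [hG, max_eq_left hs, max_eq_right (neg_nonpos.mpr hs), h0]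
  have hGneg : ∀ s, 0 ≤ s → G (-s) = -q s := by
    intro s hs
    simp [hG, max_eq_left hs, max_eq_right (neg_nonpos.mpr hs), h0]
  let f : C(AddCircle (2 : ℝ), ℂ) :=
    ⟨AddCircle.liftIco 2 (-1) G, AddCircle.liftIco_continuous hGper hGc⟩
  set b : ℤ → ℝ := fun n => ∫ s in (0 : ℝ)..1, q s * sin (n * π * s) with hb
  have hcoeff : ∀ n : ℤ, fourierCoeff f n = -Complex.I * b n := by
    intro n
    have hf : fourierCoeff f n = _ := fourierCoeff_liftIco_eq (T := 2) (a := -1) G n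
    rw [hf, fourierCoeffOn_eq_integral]
    set E : ℝ → ℂ := fun s => Complex.exp (-(n * π * s : ℝ) * Complex.I) * G s with hE
    have hcont : ContinuousOn E (Icc (-1) (-1 + 2)) :=
      ContinuousOn.mul (Continuous.continuousOn (by fun_prop)) hGc
    have e2 : (-1 + 2 : ℝ) = 1 := by norm_num
    have hEeq : (fun s : ℝ => (fourier (-n) : C(AddCircle (-1 + 2 - -1 : ℝ), ℂ))
        (s : AddCircle (-1 + 2 - -1 : ℝ)) • G s) = E := by
      funext s
      rw [fourier_coe_apply, smul_eq_mul, hE]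
      congr 2
      push_cast
      ring
    rw [hEeq]
    simp only [e2] at hcont ⊢
    have hi₁ : IntervalIntegrable E MeasureTheory.volume (-1) 0 :=
      (hcont.mono (by
        rw [uIcc_of_le (by norm_num)]
        exact Icc_subset_Icc le_rfl zero_le_one)).intervalIntegrable
    have hi₂ : IntervalIntegrable E MeasureTheory.volume 0 1 :=
      (hcont.mono (by
        rw [uIcc_of_le (by norm_num)]
        exact Icc_subset_Icc (by norm_num) le_rfl)).intervalIntegrable
    have hi₃ : IntervalIntegrable (fun s => E (-s)) MeasureTheory.volume 0 1 := by
      have := hi₁.comp_sub_left 0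
      simpa using this.symm
    -- Folding `[-1, 0]` onto `[0, 1]` by oddness of `G` leaves only the sine part of the
    -- exponential.
    rw [← intervalIntegral.integral_add_adjacent_intervals hi₁ hi₂]
    have hneg := intervalIntegral.integral_comp_neg (a := 0) (b := 1) E
    rw [neg_zero] at hneg
    rw [← hneg, ← intervalIntegral.integral_add hi₃ hi₂, hb, ← intervalIntegral.integral_ofReal,
      ← intervalIntegral.integral_const_mul, ← intervalIntegral.integral_smul]
    refine intervalIntegral.integral_congr fun s hs => ?_
    rw [uIcc_of_le zero_le_one] at hs
    simp only [hE]
    rw [hGpos s hs.1, hGneg s hs.1, mul_neg (n * π : ℝ) s, Complex.ofReal_neg, neg_neg,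
      Complex.exp_mul_I, Complex.exp_mul_I, Complex.cos_neg, Complex.sin_neg,
      Complex.ofReal_mul (q s), Complex.ofReal_sin]
    simp only [Complex.real_smul]
    push_cast
    ring
  have hbneg : ∀ n : ℤ, b (-n) = -b n := by
    intro n
    simp only [hb]
    rw [← intervalIntegral.integral_neg]
    congr 1; funext s
    push_cast
    rw [neg_mul, neg_mul, sin_neg]; ring
  have hbnat : ∀ k : ℕ, sineCoeff q k = 2 * b k := by
    intro k
    simp [sineCoeff, hb, freq]
  have hsb : Summable fun k : ℕ => b k := by
    refine (summable_nat_add_iff 1).mp ((hs.mul_left (1 / 2)).congr fun k => ?_)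
    rw [hbnat]; ring
  have hsumm : Summable (fourierCoeff f) := by
    have h₁ : Summable fun k : ℕ => (b k : ℂ) := Complex.summable_ofReal.mpr hsb
    refine Summable.of_nat_of_neg ?_ ?_
    · exact (h₁.mul_left (-Complex.I)).congr fun k => (hcoeff k).symm
    · refine (h₁.mul_left Complex.I).congr fun k => ?_
      rw [hcoeff, hbneg]
      push_cast
      ring
  have hmain := has_pointwise_sum_fourier_series_of_summable hsumm (t : AddCircle (2 : ℝ))
  have hft : f (t : AddCircle (2 : ℝ)) = q t := by
    -- The lift to the circle uses representatives in `[-1, 1)`, so `t = 1` is read at `-1`.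
    rcases ht.2.eq_or_lt with rfl | hlt
    · have : ((1 : ℝ) : AddCircle (2 : ℝ)) = ((-1 : ℝ) : AddCircle (2 : ℝ)) := by
        have := AddCircle.coe_add_period (2 : ℝ) (-1)
        rw [← this]; norm_num
      change AddCircle.liftIco 2 (-1) G ((1 : ℝ) : AddCircle (2 : ℝ)) = _
      rw [this, AddCircle.liftIco_coe_apply (by norm_num), hGneg 1 zero_le_one]
      simp [h1]
    · change AddCircle.liftIco 2 (-1) G (t : AddCircle (2 : ℝ)) = _
      rw [AddCircle.liftIco_coe_apply ⟨by linarith [ht.1], by linarith⟩, hGpos t ht.1]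
  have hnat := hmain.nat_add_neg
  have hb0 : b 0 = 0 := by simp [hb]
  have hreal : HasSum (fun k : ℕ => sineCoeff q k * sin (freq k * t)) (q t) := by
    rw [← Complex.hasSum_ofReal]
    rw [hft, hcoeff 0, hb0] at hnat
    simp only [Complex.ofReal_zero, mul_zero, zero_smul, add_zero] at hnat
    refine hnat.congr_fun ?_
    intro k
    have x₁ : 2 * (π : ℂ) * Complex.I * ((-(k : ℤ) : ℤ) : ℂ) * (t : ℂ) / ((2 : ℝ) : ℂ)
        = (-(freq k * t : ℝ) : ℂ) * Complex.I := by simp only [freq]; push_cast; ring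
    have x₂ : 2 * (π : ℂ) * Complex.I * ((k : ℤ) : ℂ) * (t : ℂ) / ((2 : ℝ) : ℂ)
        = ((freq k * t : ℝ) : ℂ) * Complex.I := by simp only [freq]; push_cast; ring
    rw [hcoeff, hcoeff, hbneg, hbnat, fourier_coe_apply, fourier_coe_apply, x₁, x₂,
      Complex.exp_mul_I, Complex.exp_mul_I, Complex.cos_neg, Complex.sin_neg, Complex.ofReal_mul,
      Complex.ofReal_sin]
    simp only [smul_eq_mul]
    push_cast
    linear_combination (2 * (b k : ℂ) * Complex.sin (freq k * t)) * Complex.I_sq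
  have h0' : sineCoeff q 0 * sin (freq 0 * t) = 0 := by simp [freq]
  have := (hasSum_nat_add_iff' 1).mpr hreal
  simpa [h0'] using this

end ContactData

/-! ### Estimates for `a'' = ω² a + g` on an interval. -/

theorem deriv_deriv_eq_of_hasDerivAt {c c₁ : ℝ → ℝ} {c₂ : ℝ} {s : Set ℝ} {x : ℝ} (hs : IsOpen s)
    (hx : x ∈ s) (h : ∀ y ∈ s, HasDerivAt c (c₁ y) y) (h₁ : HasDerivAt c₁ c₂ x) :
    deriv (deriv c) x = c₂ := by
  have : deriv c =ᶠ[nhds x] c₁ := by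
    filter_upwards [hs.mem_nhds hx] with y hy using (h y hy).deriv
  rw [this.deriv_eq, h₁.deriv]

/-- Comparison principle for the operator `c'' - ω² c` on an interval. -/
theorem nonneg_of_second_deriv_le {α β ω : ℝ} (hω : 0 < ω) {c c₁ c₂ : ℝ → ℝ}
    (hc : ContinuousOn c (Icc α β)) (h₁ : ∀ x ∈ Ioo α β, HasDerivAt c (c₁ x) x)
    (h₂ : ∀ x ∈ Ioo α β, HasDerivAt c₁ (c₂ x) x) (hle : ∀ x ∈ Ioo α β, c₂ x ≤ ω ^ 2 * c x)
    (hα : 0 ≤ c α) (hβ : 0 ≤ c β) {x : ℝ} (hx : x ∈ Icc α β) : 0 ≤ c x := by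
  obtain ⟨m, hm, hmin⟩ := isCompact_Icc.exists_isMinOn ⟨x, hx⟩ hc
  refine le_trans ?_ (hmin hx)
  -- At a negative minimum, necessarily interior, `c'' ≥ 0` contradicts `c'' ≤ ω² c < 0`.
  by_contra! hneg
  have hm' : m ∈ Ioo α β := by
    refine ⟨lt_of_le_of_ne hm.1 ?_, lt_of_le_of_ne hm.2 ?_⟩
    · rintro rfl; linarith
    · rintro rfl; linarith
  have hn : Ioo α β ∈ nhds m := isOpen_Ioo.mem_nhds hm'
  have hloc : IsLocalMax (fun y => -c y) m := by
    filter_upwards [hn] with y hy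
    exact neg_le_neg (hmin (Ioo_subset_Icc_self hy))
  have h := deriv_deriv_nonpos_of_isLocalMax hloc
    (h₁ m hm').continuousAt.neg
  rw [deriv_deriv_eq_of_hasDerivAt isOpen_Ioo hm' (fun y hy => (h₁ y hy).fun_neg)
    (h₂ m hm').fun_neg] at h
  have := hle m hm'
  have : ω ^ 2 * c m < 0 := mul_neg_of_pos_of_neg (by positivity) hneg
  linarith

/-- The right-hand side `ψ` satisfies `ψ'' = ω² ψ - K` and dominates `|a|` at both ends, so the
comparison principle applies to `ψ + a` and `ψ - a`. The exponential weights are kept for the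
interior gain of decay. -/
theorem abs_le_of_second_deriv_eq {α β ω K : ℝ} (hω : 0 < ω) {a a₁ g : ℝ → ℝ}
    (ha : ContinuousOn a (Icc α β)) (h₁ : ∀ x ∈ Ioo α β, HasDerivAt a (a₁ x) x)
    (h₂ : ∀ x ∈ Ioo α β, HasDerivAt a₁ (ω ^ 2 * a x + g x) x)
    (hK : 0 ≤ K) (hg : ∀ x ∈ Ioo α β, |g x| ≤ K) {x : ℝ} (hx : x ∈ Icc α β) :
    |a x| ≤ |a α| * exp (-(ω * (x - α))) + |a β| * exp (-(ω * (β - x))) + K / ω ^ 2 := by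
  have hω2 : 0 < ω ^ 2 := by positivity
  set ψ : ℝ → ℝ := fun y => |a α| * exp (-(ω * (y - α))) + |a β| * exp (-(ω * (β - y))) + K / ω ^ 2
    with hψ
  set ψ₁ : ℝ → ℝ := fun y =>
    -ω * (|a α| * exp (-(ω * (y - α)))) + ω * (|a β| * exp (-(ω * (β - y)))) with hψ₁
  have e₁ : ∀ y, HasDerivAt (fun y => |a α| * exp (-(ω * (y - α))))
      (-ω * (|a α| * exp (-(ω * (y - α))))) y := by
    intro y
    have := ((((hasDerivAt_id y).sub_const α).const_mul ω).neg.exp).const_mul |a α|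
    exact this.congr_deriv (by simp only [id, Pi.neg_apply]; ring)
  have e₂ : ∀ y, HasDerivAt (fun y => |a β| * exp (-(ω * (β - y))))
      (ω * (|a β| * exp (-(ω * (β - y))))) y := by
    intro y
    have := ((((hasDerivAt_id y).const_sub β).const_mul ω).neg.exp).const_mul |a β|
    exact this.congr_deriv (by simp only [id, Pi.neg_apply]; ring)
  have d₁ : ∀ y, HasDerivAt ψ (ψ₁ y) y := fun y => ((e₁ y).add (e₂ y)).add_const _
  have d₂ : ∀ y, HasDerivAt ψ₁ (ω ^ 2 * ψ y - K) y := by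
    intro y
    refine (((e₁ y).const_mul (-ω)).add ((e₂ y).const_mul ω)).congr_deriv ?_
    simp only [hψ]
    field_simp
    ring
  have hψc : Continuous ψ := continuous_iff_continuousAt.mpr fun y => (d₁ y).continuousAt
  have hKω : 0 ≤ K / ω ^ 2 := by positivity
  have bα : |a α| ≤ ψ α := by
    have : 0 ≤ |a β| * exp (-(ω * (β - α))) := by positivity
    simp only [hψ, sub_self, mul_zero, neg_zero, exp_zero, mul_one]
    linarith
  have bβ : |a β| ≤ ψ β := by
    have : 0 ≤ |a α| * exp (-(ω * (β - α))) := by positivity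
    simp only [hψ, sub_self, mul_zero, neg_zero, exp_zero, mul_one]
    linarith
  rw [abs_le]
  constructor
  · have := nonneg_of_second_deriv_le hω (c := fun y => ψ y + a y) (hψc.continuousOn.add ha)
      (fun y hy => (d₁ y).add (h₁ y hy)) (fun y hy => (d₂ y).add (h₂ y hy))
      (fun y hy => by have := (abs_le.mp (hg y hy)).2; linarith)
      (by linarith [neg_abs_le (a α)]) (by linarith [neg_abs_le (a β)]) hx
    linarith
  · have := nonneg_of_second_deriv_le hω (c := fun y => ψ y - a y) (hψc.continuousOn.sub ha)
      (fun y hy => (d₁ y).sub (h₁ y hy)) (fun y hy => (d₂ y).sub (h₂ y hy))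
      (fun y hy => by have := (abs_le.mp (hg y hy)).1; linarith)
      (by linarith [le_abs_self (a α)]) (by linarith [le_abs_self (a β)]) hx
    linarith

theorem abs_le_add_of_second_deriv_eq {α β ω K : ℝ} (hω : 0 < ω) {a a₁ g : ℝ → ℝ}
    (ha : ContinuousOn a (Icc α β)) (h₁ : ∀ x ∈ Ioo α β, HasDerivAt a (a₁ x) x)
    (h₂ : ∀ x ∈ Ioo α β, HasDerivAt a₁ (ω ^ 2 * a x + g x) x)
    (hK : 0 ≤ K) (hg : ∀ x ∈ Ioo α β, |g x| ≤ K) {x : ℝ} (hx : x ∈ Icc α β) :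
    |a x| ≤ |a α| + |a β| + K / ω ^ 2 := by
  have h := abs_le_of_second_deriv_eq hω ha h₁ h₂ hK hg hx
  have e₁ : exp (-(ω * (x - α))) ≤ 1 := exp_le_one_iff.mpr (by nlinarith [hx.1])
  have e₂ : exp (-(ω * (β - x))) ≤ 1 := exp_le_one_iff.mpr (by nlinarith [hx.2])
  nlinarith [abs_nonneg (a α), abs_nonneg (a β)]

theorem sq_mul_exp_neg_le {y : ℝ} (hy : 0 ≤ y) : y ^ 2 * exp (-y) ≤ 2 := by
  have := quadratic_le_exp_of_nonneg hy
  rw [exp_neg, ← div_eq_mul_inv, div_le_iff₀ (exp_pos y)]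
  linarith

/-- Interior bound: the boundary values enter with a gain of `ω²`. -/
theorem sq_mul_abs_le_of_second_deriv_eq {α β ω K δ : ℝ} (hω : 0 < ω) (hδ : 0 < δ)
    {a a₁ g : ℝ → ℝ}
    (ha : ContinuousOn a (Icc α β)) (h₁ : ∀ x ∈ Ioo α β, HasDerivAt a (a₁ x) x)
    (h₂ : ∀ x ∈ Ioo α β, HasDerivAt a₁ (ω ^ 2 * a x + g x) x)
    (hK : 0 ≤ K) (hg : ∀ x ∈ Ioo α β, |g x| ≤ K) {x : ℝ} (hx : x ∈ Icc (α + δ) (β - δ)) :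
    ω ^ 2 * |a x| ≤ 2 / δ ^ 2 * (|a α| + |a β|) + K := by
  have h := abs_le_of_second_deriv_eq hω ha h₁ h₂ hK hg
    (x := x) ⟨by linarith [hx.1], by linarith [hx.2]⟩
  have key : ∀ z, δ ≤ z → ω ^ 2 * exp (-(ω * z)) ≤ 2 / δ ^ 2 := by
    intro z hz
    have h₁ := sq_mul_exp_neg_le (y := ω * δ) (by positivity)
    have h₂ : exp (-(ω * z)) ≤ exp (-(ω * δ)) := exp_le_exp.mpr (by nlinarith)
    rw [le_div_iff₀ (by positivity)]
    nlinarith [mul_le_mul_of_nonneg_left h₂ (show 0 ≤ ω ^ 2 * δ ^ 2 by positivity)]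
  have k₁ := mul_le_mul_of_nonneg_left (key (x - α) (by linarith [hx.1])) (abs_nonneg (a α))
  have k₂ := mul_le_mul_of_nonneg_left (key (β - x) (by linarith [hx.2])) (abs_nonneg (a β))
  have h' := mul_le_mul_of_nonneg_left h (show 0 ≤ ω ^ 2 by positivity)
  have : ω ^ 2 * (K / ω ^ 2) = K := by field_simp
  nlinarith

/-- Interpolation between `a` and `a''`: somewhere in the interval `a'` equals the mean slope, at
most `2A/d` in modulus, and from there to `x` it changes by at most `dB`. The length `d` stays free
so that it can be scaled like `1/ω`. -/
theorem abs_deriv_le_of_abs_le {x d A B : ℝ} (hd : 0 < d) {a a₁ a₂ : ℝ → ℝ}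
    (h₁ : ∀ y ∈ Icc x (x + d), HasDerivAt a (a₁ y) y)
    (h₂ : ∀ y ∈ Icc x (x + d), HasDerivAt a₁ (a₂ y) y)
    (hA : ∀ y ∈ Icc x (x + d), |a y| ≤ A) (hB : ∀ y ∈ Icc x (x + d), |a₂ y| ≤ B) :
    |a₁ x| ≤ 2 * A / d + d * B := by
  have hlt : x < x + d := by linarith
  obtain ⟨y, hy, hya⟩ := exists_hasDerivAt_eq_slope a a₁ hlt
    (fun z hz => (h₁ z hz).continuousAt.continuousWithinAt)
    (fun z hz => h₁ z (Ioo_subset_Icc_self hz))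
  obtain ⟨z, hz, hza⟩ := exists_hasDerivAt_eq_slope a₁ a₂ hy.1
    (fun w hw => (h₂ w ⟨hw.1, hw.2.trans hy.2.le⟩).continuousAt.continuousWithinAt)
    (fun w hw => h₂ w ⟨hw.1.le, hw.2.le.trans hy.2.le⟩)
  have b₁ : |a₁ y| ≤ 2 * A / d := by
    rw [hya, add_sub_cancel_left, abs_div, abs_of_pos hd]
    gcongr
    have := hA x ⟨le_rfl, hlt.le⟩
    have := hA (x + d) ⟨hlt.le, le_rfl⟩
    exact (abs_sub _ _).trans (by linarith)
  have hyx : 0 < y - x := by linarith [hy.1]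
  have b₂ : |a₁ y - a₁ x| ≤ d * B := by
    rw [eq_div_iff hyx.ne'] at hza
    rw [← hza, abs_mul, abs_of_pos hyx, mul_comm]
    have hBz := hB z ⟨hz.1.le, hz.2.le.trans hy.2.le⟩
    have := (abs_nonneg _).trans hBz
    have : y - x ≤ d := by linarith [hy.2]
    gcongr
  calc |a₁ x| = |a₁ y - (a₁ y - a₁ x)| := by congr 1; ring
    _ ≤ |a₁ y| + |a₁ y - a₁ x| := abs_sub _ _
    _ ≤ _ := add_le_add b₁ b₂

/-! ### Second-order differentiation of separated series in the plane. -/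

/-- The linear form `(y₁, y₂) ↦ a y₁ + b y₂` on the plane. -/
def planeForm (a b : ℝ) : ℝ × ℝ →L[ℝ] ℝ :=
  a • ContinuousLinearMap.fst ℝ ℝ ℝ + b • ContinuousLinearMap.snd ℝ ℝ ℝ

theorem planeForm_apply (a b : ℝ) (y : ℝ × ℝ) : planeForm a b y = a * y.1 + b * y.2 := by
  simp [planeForm]

theorem norm_planeForm_le (a b : ℝ) : ‖planeForm a b‖ ≤ |a| + |b| := by
  refine ContinuousLinearMap.opNorm_le_bound _ (by positivity) fun y => ?_
  rw [planeForm_apply, norm_eq_abs]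
  have h₁ : |y.1| ≤ ‖y‖ := norm_fst_le y
  have h₂ : |y.2| ≤ ‖y‖ := norm_snd_le y
  calc |a * y.1 + b * y.2| ≤ |a| * |y.1| + |b| * |y.2| := by
        rw [← abs_mul, ← abs_mul]; exact abs_add_le _ _
    _ ≤ |a| * ‖y‖ + |b| * ‖y‖ := by gcongr
    _ = _ := by ring

theorem planeForm_add (a b c d : ℝ) : planeForm a b + planeForm c d = planeForm (a + c) (b + d) := by
  ext <;> simp [planeForm_apply]

theorem planeForm_tsum {a b : ℕ → ℝ} (ha : Summable a) (hb : Summable b) :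
    ∑' k, planeForm (a k) (b k) = planeForm (∑' k, a k) (∑' k, b k) :=
  ((ha.hasSum.smul_const _).add (hb.hasSum.smul_const _)).tsum_eq

theorem hasFDerivAt_mul_planeForm {b e : ℝ → ℝ} {b' e' : ℝ} {x : ℝ × ℝ}
    (hb : HasDerivAt b b' x.1) (he : HasDerivAt e e' x.2) :
    HasFDerivAt (fun y : ℝ × ℝ => b y.1 * e y.2) (planeForm (b' * e x.2) (b x.1 * e')) x := by
  have h₁ : HasFDerivAt (fun y : ℝ × ℝ => b y.1) (b' • ContinuousLinearMap.fst ℝ ℝ ℝ) x :=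
    hb.comp_hasFDerivAt x hasFDerivAt_fst
  have h₂ : HasFDerivAt (fun y : ℝ × ℝ => e y.2) (e' • ContinuousLinearMap.snd ℝ ℝ ℝ) x :=
    he.comp_hasFDerivAt x hasFDerivAt_snd
  refine (h₁.mul h₂).congr_fderiv ?_
  ext <;> simp [planeForm, mul_comm]

/-- `u` is twice continuously differentiable on `s`, with the given partial derivatives. -/
structure HasPlaneJetOn (s : Set (ℝ × ℝ)) (u u₁ u₂ u₁₁ u₁₂ u₂₂ : ℝ × ℝ → ℝ) : Prop where
  hasFDerivAt : ∀ x ∈ s, HasFDerivAt u (planeForm (u₁ x) (u₂ x)) x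
  hasFDerivAt_fst : ∀ x ∈ s, HasFDerivAt u₁ (planeForm (u₁₁ x) (u₁₂ x)) x
  hasFDerivAt_snd : ∀ x ∈ s, HasFDerivAt u₂ (planeForm (u₁₂ x) (u₂₂ x)) x
  continuousOn_fst_fst : ContinuousOn u₁₁ s
  continuousOn_fst_snd : ContinuousOn u₁₂ s
  continuousOn_snd_snd : ContinuousOn u₂₂ s

theorem contDiffOn_one_of_planeForm {s : Set (ℝ × ℝ)} (hs : IsOpen s) {u u₁ u₂ : ℝ × ℝ → ℝ}
    (h : ∀ x ∈ s, HasFDerivAt u (planeForm (u₁ x) (u₂ x)) x) (h₁ : ContinuousOn u₁ s)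
    (h₂ : ContinuousOn u₂ s) : ContDiffOn ℝ 1 u s := by
  have : (1 : WithTop ℕ∞) = 0 + 1 := by norm_num
  rw [this, contDiffOn_succ_iff_fderiv_of_isOpen hs, contDiffOn_zero]
  refine ⟨fun x hx => (h x hx).differentiableAt.differentiableWithinAt, by simp, ?_⟩
  refine ContinuousOn.congr (f := fun x => planeForm (u₁ x) (u₂ x)) ?_ fun x hx => (h x hx).fderiv
  exact (h₁.smul continuousOn_const).add (h₂.smul continuousOn_const)

theorem hasDerivAt_slice_fst {u : ℝ × ℝ → ℝ} {a b : ℝ} {x : ℝ × ℝ}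
    (h : HasFDerivAt u (planeForm a b) x) : HasDerivAt (fun s => u (s, x.2)) a x.1 := by
  have := HasFDerivAt.comp_hasDerivAt (f := fun s : ℝ => (s, x.2)) x.1 (l := u)
    (l' := planeForm a b) h ((hasDerivAt_id x.1).prodMk (hasDerivAt_const x.1 x.2))
  simpa [planeForm_apply, Function.comp_def] using this

theorem hasDerivAt_slice_snd {u : ℝ × ℝ → ℝ} {a b : ℝ} {x : ℝ × ℝ}
    (h : HasFDerivAt u (planeForm a b) x) : HasDerivAt (fun t => u (x.1, t)) b x.2 := by
  have := HasFDerivAt.comp_hasDerivAt (f := fun t : ℝ => (x.1, t)) x.2 (l := u)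
    (l' := planeForm a b) h ((hasDerivAt_const x.2 x.1).prodMk (hasDerivAt_id x.2))
  simpa [planeForm_apply, Function.comp_def] using this

namespace HasPlaneJetOn

variable {s : Set (ℝ × ℝ)} {u u₁ u₂ u₁₁ u₁₂ u₂₂ v v₁ v₂ v₁₁ v₁₂ v₂₂ : ℝ × ℝ → ℝ}

theorem contDiffOn (h : HasPlaneJetOn s u u₁ u₂ u₁₁ u₁₂ u₂₂) (hs : IsOpen s) :
    ContDiffOn ℝ 2 u s := by
  have : (2 : WithTop ℕ∞) = 1 + 1 := by norm_num
  rw [this, contDiffOn_succ_iff_fderiv_of_isOpen hs]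
  refine ⟨fun x hx => (h.hasFDerivAt x hx).differentiableAt.differentiableWithinAt, by simp, ?_⟩
  refine ContDiffOn.congr (f := fun x => planeForm (u₁ x) (u₂ x)) ?_
    fun x hx => (h.hasFDerivAt x hx).fderiv
  exact ((contDiffOn_one_of_planeForm hs h.hasFDerivAt_fst h.continuousOn_fst_fst
    h.continuousOn_fst_snd).smul contDiffOn_const).add
    ((contDiffOn_one_of_planeForm hs h.hasFDerivAt_snd h.continuousOn_fst_snd
    h.continuousOn_snd_snd).smul contDiffOn_const)

theorem planeLaplacian_eq (h : HasPlaneJetOn s u u₁ u₂ u₁₁ u₁₂ u₂₂) (hs : IsOpen s) {x : ℝ × ℝ}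
    (hx : x ∈ s) : planeLaplacian u x = u₁₁ x + u₂₂ x := by
  rw [planeLaplacian, iteratedDeriv_two_eq, iteratedDeriv_two_eq]
  congr 1
  · have hc : Continuous fun y : ℝ => ((y, x.2) : ℝ × ℝ) := by fun_prop
    exact deriv_deriv_eq_of_hasDerivAt (hs.preimage hc) (x := x.1) hx
      (fun y hy => hasDerivAt_slice_fst (x := (y, x.2)) (h.hasFDerivAt _ hy))
      (hasDerivAt_slice_fst (h.hasFDerivAt_fst x hx))
  · have hc : Continuous fun y : ℝ => ((x.1, y) : ℝ × ℝ) := by fun_prop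
    exact deriv_deriv_eq_of_hasDerivAt (hs.preimage hc) (x := x.2) hx
      (fun y hy => hasDerivAt_slice_snd (x := (x.1, y)) (h.hasFDerivAt _ hy))
      (hasDerivAt_slice_snd (h.hasFDerivAt_snd x hx))

theorem add (h : HasPlaneJetOn s u u₁ u₂ u₁₁ u₁₂ u₂₂) (h' : HasPlaneJetOn s v v₁ v₂ v₁₁ v₁₂ v₂₂) :
    HasPlaneJetOn s (fun x => u x + v x) (fun x => u₁ x + v₁ x) (fun x => u₂ x + v₂ x)
      (fun x => u₁₁ x + v₁₁ x) (fun x => u₁₂ x + v₁₂ x) (fun x => u₂₂ x + v₂₂ x) where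
  hasFDerivAt x hx := planeForm_add _ _ _ _ ▸ (h.hasFDerivAt x hx).add (h'.hasFDerivAt x hx)
  hasFDerivAt_fst x hx :=
    planeForm_add _ _ _ _ ▸ (h.hasFDerivAt_fst x hx).add (h'.hasFDerivAt_fst x hx)
  hasFDerivAt_snd x hx :=
    planeForm_add _ _ _ _ ▸ (h.hasFDerivAt_snd x hx).add (h'.hasFDerivAt_snd x hx)
  continuousOn_fst_fst := h.continuousOn_fst_fst.add h'.continuousOn_fst_fst
  continuousOn_fst_snd := h.continuousOn_fst_snd.add h'.continuousOn_fst_snd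
  continuousOn_snd_snd := h.continuousOn_snd_snd.add h'.continuousOn_snd_snd

end HasPlaneJetOn

/-- Serves for the corrector terms, products of an edge value of `f` and a polynomial profile. -/
theorem hasPlaneJetOn_mul {I : Set ℝ} {b b₁ b₂ e e₁ e₂ : ℝ → ℝ}
    (hb : ∀ x ∈ I, HasDerivAt b (b₁ x) x) (hb₁ : ∀ x ∈ I, HasDerivAt b₁ (b₂ x) x)
    (hb₂ : ContinuousOn b₂ I) (he : ∀ t, HasDerivAt e (e₁ t) t)
    (he₁ : ∀ t, HasDerivAt e₁ (e₂ t) t) (he₂ : Continuous e₂) :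
    HasPlaneJetOn (I ×ˢ univ) (fun x => b x.1 * e x.2) (fun x => b₁ x.1 * e x.2)
      (fun x => b x.1 * e₁ x.2) (fun x => b₂ x.1 * e x.2) (fun x => b₁ x.1 * e₁ x.2)
      (fun x => b x.1 * e₂ x.2) := by
  have ce : Continuous e := continuous_iff_continuousAt.mpr fun t => (he t).continuousAt
  have ce₁ : Continuous e₁ := continuous_iff_continuousAt.mpr fun t => (he₁ t).continuousAt
  have cb : ContinuousOn b I := fun x hx => (hb x hx).continuousAt.continuousWithinAt
  have cb₁ : ContinuousOn b₁ I := fun x hx => (hb₁ x hx).continuousAt.continuousWithinAt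
  have key : ∀ {f g : ℝ → ℝ}, ContinuousOn f I → Continuous g →
      ContinuousOn (fun x : ℝ × ℝ => f x.1 * g x.2) (I ×ˢ univ) := fun hf hg =>
    (hf.comp continuousOn_fst fun x hx => hx.1).mul (hg.comp continuous_snd).continuousOn
  exact
    { hasFDerivAt := fun x hx => hasFDerivAt_mul_planeForm (hb _ hx.1) (he _)
      hasFDerivAt_fst := fun x hx => hasFDerivAt_mul_planeForm (hb₁ _ hx.1) (he _)
      hasFDerivAt_snd := fun x hx => hasFDerivAt_mul_planeForm (hb _ hx.1) (he₁ _)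
      continuousOn_fst_fst := key hb₂ ce
      continuousOn_fst_snd := key cb₁ ce₁
      continuousOn_snd_snd := key cb he₂ }

theorem hasFDerivAt_tsum_mul {b b' e e' : ℕ → ℝ → ℝ} {M : ℕ → ℝ} {p q : ℝ} (hM : Summable M)
    (hb : ∀ k, ∀ x ∈ Ioo p q, HasDerivAt (b k) (b' k x) x)
    (he : ∀ k t, HasDerivAt (e k) (e' k t) t)
    (h₀ : ∀ k, ∀ x ∈ Ioo p q, ∀ t, |b k x * e k t| ≤ M k)
    (h₁ : ∀ k, ∀ x ∈ Ioo p q, ∀ t, |b' k x * e k t| ≤ M k)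
    (h₂ : ∀ k, ∀ x ∈ Ioo p q, ∀ t, |b k x * e' k t| ≤ M k) {x : ℝ × ℝ}
    (hx : x ∈ Ioo p q ×ˢ (univ : Set ℝ)) :
    HasFDerivAt (fun y : ℝ × ℝ => ∑' k, b k y.1 * e k y.2)
      (planeForm (∑' k, b' k x.1 * e k x.2) (∑' k, b k x.1 * e' k x.2)) x := by
  have s₀ : Summable fun k => b k x.1 * e k x.2 :=
    Summable.of_norm_bounded hM fun k => h₀ k _ hx.1 _
  have s₁ : Summable fun k => b' k x.1 * e k x.2 :=
    Summable.of_norm_bounded hM fun k => h₁ k _ hx.1 _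
  have s₂ : Summable fun k => b k x.1 * e' k x.2 :=
    Summable.of_norm_bounded hM fun k => h₂ k _ hx.1 _
  rw [← planeForm_tsum s₁ s₂]
  refine hasFDerivAt_tsum_of_isPreconnected (u := fun k => M k + M k)
    (f' := fun k y => planeForm (b' k y.1 * e k y.2) (b k y.1 * e' k y.2))
    (hM.add hM) (isOpen_Ioo.prod isOpen_univ)
    ((convex_Ioo p q).prod convex_univ).isPreconnected
    (fun k y hy => hasFDerivAt_mul_planeForm (hb k _ hy.1) (he k _))
    (fun k y hy => (norm_planeForm_le _ _).trans (add_le_add (h₁ k _ hy.1 _) (h₂ k _ hy.1 _)))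
    hx s₀ hx

/-- Each `x₂`-derivative costs a factor `ω`, whence the weights `ω²`, `ω`, `1` on `a`, `a'`, `a''`.
Since `ω ≥ 1`, these three bounds also dominate every lower-order series. -/
theorem hasPlaneJetOn_tsum_mul_sin {a a₁ a₂ : ℕ → ℝ → ℝ} {ω M : ℕ → ℝ} {p q : ℝ}
    (hω : ∀ k, 1 ≤ ω k) (hM : Summable M)
    (ha : ∀ k, ∀ x ∈ Ioo p q, HasDerivAt (a k) (a₁ k x) x)
    (ha₁ : ∀ k, ∀ x ∈ Ioo p q, HasDerivAt (a₁ k) (a₂ k x) x)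
    (ha₂ : ∀ k, ContinuousOn (a₂ k) (Ioo p q))
    (hb : ∀ k, ∀ x ∈ Ioo p q, ω k ^ 2 * |a k x| ≤ M k)
    (hb₁ : ∀ k, ∀ x ∈ Ioo p q, ω k * |a₁ k x| ≤ M k)
    (hb₂ : ∀ k, ∀ x ∈ Ioo p q, |a₂ k x| ≤ M k) :
    HasPlaneJetOn (Ioo p q ×ˢ univ) (fun x => ∑' k, a k x.1 * sin (ω k * x.2))
      (fun x => ∑' k, a₁ k x.1 * sin (ω k * x.2))
      (fun x => ∑' k, a k x.1 * (ω k * cos (ω k * x.2)))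
      (fun x => ∑' k, a₂ k x.1 * sin (ω k * x.2))
      (fun x => ∑' k, a₁ k x.1 * (ω k * cos (ω k * x.2)))
      (fun x => ∑' k, a k x.1 * (-ω k ^ 2 * sin (ω k * x.2))) := by
  have ds : ∀ k t, HasDerivAt (fun t => sin (ω k * t)) (ω k * cos (ω k * t)) t := fun k t => by
    refine ((hasDerivAt_id t).const_mul (ω k)).sin.congr_deriv ?_
    simp only [id]; ring
  have dc : ∀ k t, HasDerivAt (fun t => ω k * cos (ω k * t)) (-ω k ^ 2 * sin (ω k * t)) t :=
    fun k t => by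
    refine (((hasDerivAt_id t).const_mul (ω k)).cos.const_mul (ω k)).congr_deriv ?_
    simp only [id]; ring
  have hω0 : ∀ k, 0 ≤ ω k := fun k => zero_le_one.trans (hω k)
  have bnd : ∀ k z w, |w| ≤ 1 → |z| ≤ M k → |z * w| ≤ M k := fun k z w hw hz => by
    rw [abs_mul]
    nlinarith [abs_nonneg z, abs_nonneg w]
  have bs : ∀ k z t, |z| ≤ M k → |z * sin (ω k * t)| ≤ M k := fun k z t =>
    bnd k z _ (abs_sin_le_one _)
  have bc : ∀ k z t, ω k * |z| ≤ M k → |z * (ω k * cos (ω k * t))| ≤ M k := fun k z t hz => by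
    rw [← mul_assoc]
    refine bnd k _ _ (abs_cos_le_one _) ?_
    rwa [abs_mul, abs_of_nonneg (hω0 k), mul_comm]
  have bss : ∀ k z t, ω k ^ 2 * |z| ≤ M k → |z * (-ω k ^ 2 * sin (ω k * t))| ≤ M k :=
    fun k z t hz => by
    rw [← mul_assoc]
    refine bnd k _ _ (abs_sin_le_one _) ?_
    rwa [abs_mul, abs_neg, abs_of_nonneg (sq_nonneg (ω k)), mul_comm]
  have hb' : ∀ k, ∀ x ∈ Ioo p q, ω k * |a k x| ≤ M k := fun k x hx => by
    refine le_trans ?_ (hb k x hx)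
    nlinarith [mul_nonneg (hω0 k) (abs_nonneg (a k x)), hω k]
  have hb'' : ∀ k, ∀ x ∈ Ioo p q, |a k x| ≤ M k := fun k x hx => by
    refine le_trans ?_ (hb' k x hx)
    nlinarith [abs_nonneg (a k x), hω k]
  have hb₁' : ∀ k, ∀ x ∈ Ioo p q, |a₁ k x| ≤ M k := fun k x hx => by
    refine le_trans ?_ (hb₁ k x hx)
    nlinarith [abs_nonneg (a₁ k x), hω k]
  have cont : ∀ {f g : ℕ → ℝ → ℝ}, (∀ k, ContinuousOn (f k) (Ioo p q)) → (∀ k, Continuous (g k)) →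
      (∀ k, ∀ x ∈ Ioo p q, ∀ t, |f k x * g k t| ≤ M k) →
      ContinuousOn (fun x : ℝ × ℝ => ∑' k, f k x.1 * g k x.2) (Ioo p q ×ˢ univ) :=
    fun hf hg hfg => continuousOn_tsum
      (fun k => ((hf k).comp continuousOn_fst fun x hx => hx.1).mul
        ((hg k).comp continuous_snd).continuousOn) hM fun k x hx => hfg k _ hx.1 _
  exact
    { hasFDerivAt := fun x hx => hasFDerivAt_tsum_mul hM ha ds
        (fun k x hx t => bs k _ t (hb'' k x hx)) (fun k x hx t => bs k _ t (hb₁' k x hx))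
        (fun k x hx t => bc k _ t (hb' k x hx)) hx
      hasFDerivAt_fst := fun x hx => hasFDerivAt_tsum_mul hM ha₁ ds
        (fun k x hx t => bs k _ t (hb₁' k x hx)) (fun k x hx t => bs k _ t (hb₂ k x hx))
        (fun k x hx t => bc k _ t (hb₁ k x hx)) hx
      hasFDerivAt_snd := fun x hx => hasFDerivAt_tsum_mul hM ha dc
        (fun k x hx t => bc k _ t (hb' k x hx)) (fun k x hx t => bc k _ t (hb₁ k x hx))
        (fun k x hx t => bss k _ t (hb k x hx)) hx
      continuousOn_fst_fst := cont ha₂ (fun k => by fun_prop)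
        (fun k x hx t => bs k _ t (hb₂ k x hx))
      continuousOn_fst_snd := cont
        (fun k x hx => (ha₁ k x hx).continuousAt.continuousWithinAt) (fun k => by fun_prop)
        (fun k x hx t => bc k _ t (hb₁ k x hx))
      continuousOn_snd_snd := cont
        (fun k x hx => (ha k x hx).continuousAt.continuousWithinAt) (fun k => by fun_prop)
        (fun k x hx t => bss k _ t (hb k x hx)) }

/-! ### Data on closed rectangles, edge correctors and mode families. -/

/-- Derivatives are taken within the closed rectangle because the corrector uses the values and
`x₁`-derivatives of `f` on the edges `x₂ = 0, 1`. The general order `n` permits iteration. -/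
theorem exists_partials_within {α β : ℝ} (hαβ : α < β) {n : WithTop ℕ∞} {g : ℝ × ℝ → ℝ}
    (hg : ContDiffOn ℝ (n + 1) g (Icc α β ×ˢ Icc (0 : ℝ) 1)) :
    ∃ g₁ g₂ : ℝ × ℝ → ℝ, ContDiffOn ℝ n g₁ (Icc α β ×ˢ Icc (0 : ℝ) 1) ∧
      ContDiffOn ℝ n g₂ (Icc α β ×ˢ Icc (0 : ℝ) 1) ∧
      ∀ s ∈ Icc α β, ∀ t ∈ Icc (0 : ℝ) 1,
        HasDerivWithinAt (fun s => g (s, t)) (g₁ (s, t)) (Icc α β) s ∧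
        HasDerivWithinAt (fun t => g (s, t)) (g₂ (s, t)) (Icc 0 1) t := by
  set R := Icc α β ×ˢ Icc (0 : ℝ) 1 with hR
  have hu : UniqueDiffOn ℝ R := (uniqueDiffOn_Icc hαβ).prod (uniqueDiffOn_Icc zero_lt_one)
  have hd : ContDiffOn ℝ n (fderivWithin ℝ g R) R := hg.fderivWithin hu le_rfl
  have h1 : (1 : WithTop ℕ∞) ≤ n + 1 := le_add_self
  refine ⟨fun x => fderivWithin ℝ g R x (1, 0), fun x => fderivWithin ℝ g R x (0, 1),
    hd.clm_apply contDiffOn_const, hd.clm_apply contDiffOn_const, fun s hs t ht => ⟨?_, ?_⟩⟩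
  · have hf := (hg.differentiableOn (one_pos.trans_le h1).ne' (s, t) ⟨hs, ht⟩).hasFDerivWithinAt
    exact HasFDerivWithinAt.comp_hasDerivWithinAt (f := fun s : ℝ => (s, t)) (t := R) s hf
      ((hasDerivAt_id s).prodMk (hasDerivAt_const s t)).hasDerivWithinAt fun y hy => ⟨hy, ht⟩
  · have hf := (hg.differentiableOn (one_pos.trans_le h1).ne' (s, t) ⟨hs, ht⟩).hasFDerivWithinAt
    exact HasFDerivWithinAt.comp_hasDerivWithinAt (f := fun t : ℝ => (s, t)) (t := R) t hf
      ((hasDerivAt_const t s).prodMk (hasDerivAt_id t)).hasDerivWithinAt fun y hy => ⟨hs, hy⟩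

theorem exists_second_partials_within {α β : ℝ} (hαβ : α < β) {f : ℝ × ℝ → ℝ}
    (hf : ContDiffOn ℝ 2 f (Icc α β ×ˢ Icc (0 : ℝ) 1)) :
    ∃ f₁ f₂ f₁₁ f₂₂ : ℝ × ℝ → ℝ, ContinuousOn f₁₁ (Icc α β ×ˢ Icc (0 : ℝ) 1) ∧
      ContinuousOn f₂₂ (Icc α β ×ˢ Icc (0 : ℝ) 1) ∧
      ∀ s ∈ Icc α β, ∀ t ∈ Icc (0 : ℝ) 1,
        HasDerivWithinAt (fun s => f (s, t)) (f₁ (s, t)) (Icc α β) s ∧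
        HasDerivWithinAt (fun s => f₁ (s, t)) (f₁₁ (s, t)) (Icc α β) s ∧
        HasDerivWithinAt (fun t => f (s, t)) (f₂ (s, t)) (Icc 0 1) t ∧
        HasDerivWithinAt (fun t => f₂ (s, t)) (f₂₂ (s, t)) (Icc 0 1) t := by
  have e₂ : (2 : WithTop ℕ∞) = 1 + 1 := by norm_num
  have e₁ : (1 : WithTop ℕ∞) = 0 + 1 := by norm_num
  rw [e₂] at hf
  obtain ⟨f₁, f₂, c₁, c₂, h⟩ := exists_partials_within hαβ hf
  rw [e₁] at c₁ c₂
  obtain ⟨f₁₁, _, c₁₁, _, h₁⟩ := exists_partials_within hαβ c₁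
  obtain ⟨_, f₂₂, _, c₂₂, h₂⟩ := exists_partials_within hαβ c₂
  exact ⟨f₁, f₂, f₁₁, f₂₂, c₁₁.continuousOn, c₂₂.continuousOn, fun s hs t ht =>
    ⟨(h s hs t ht).1, (h₁ s hs t ht).1, (h s hs t ht).2, (h₂ s hs t ht).2⟩⟩

namespace ContactData

theorem continuousOn_sineCoeff {α β : ℝ} (hαβ : α ≤ β) {f : ℝ × ℝ → ℝ}
    (hf : ContinuousOn f (Icc α β ×ˢ Icc (0 : ℝ) 1)) (k : ℕ) :
    ContinuousOn (fun s => sineCoeff (fun t => f (s, t)) k) (Icc α β) := by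
  -- Composition with the projections extends `f` continuously to the plane, so that continuity of
  -- parametric integrals applies.
  set F : ℝ × ℝ → ℝ := fun x => f (projIcc α β hαβ x.1, projIcc 0 1 zero_le_one x.2) with hF
  have hFc : Continuous F := hf.comp_continuous
    ((continuous_subtype_val.comp (continuous_projIcc.comp continuous_fst)).prodMk
      (continuous_subtype_val.comp (continuous_projIcc.comp continuous_snd)))
    fun x => ⟨Subtype.coe_prop _, Subtype.coe_prop _⟩
  have hc : Continuous fun s => 2 * ∫ t in (0 : ℝ)..1, F (s, t) * sin (freq k * t) :=
    continuous_const.mul (intervalIntegral.continuous_parametric_intervalIntegral_of_continuous'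
      (f := fun s t => F (s, t) * sin (freq k * t)) (by
        simp only [Function.uncurry_def]
        exact hFc.mul (by fun_prop)) 0 1)
  refine hc.continuousOn.congr fun s hs => sineCoeff_congr k fun t ht => ?_
  simp [hF, projIcc_of_mem hαβ hs, projIcc_of_mem zero_le_one ht]

theorem sineCoeff_eq_of_zero {g g₁ g₂ : ℝ → ℝ}
    (hg : ∀ t ∈ Icc (0 : ℝ) 1, HasDerivWithinAt g (g₁ t) (Icc 0 1) t)
    (hg₁ : ∀ t ∈ Icc (0 : ℝ) 1, HasDerivWithinAt g₁ (g₂ t) (Icc 0 1) t)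
    (hg₂ : ContinuousOn g₂ (Icc 0 1)) (h0 : g 0 = 0) (h1 : g 1 = 0) (k : ℕ) :
    sineCoeff g (k + 1) = -sineCoeff g₂ (k + 1) / freq (k + 1) ^ 2 := by
  rw [sineCoeff_eq_of_hasDerivWithinAt hg hg₁ hg₂, h0, h1]
  ring

theorem abs_sineCoeff_le_of_zero {g g₁ g₂ : ℝ → ℝ} {C : ℝ}
    (hg : ∀ t ∈ Icc (0 : ℝ) 1, HasDerivWithinAt g (g₁ t) (Icc 0 1) t)
    (hg₁ : ∀ t ∈ Icc (0 : ℝ) 1, HasDerivWithinAt g₁ (g₂ t) (Icc 0 1) t)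
    (hg₂ : ContinuousOn g₂ (Icc 0 1)) (h0 : g 0 = 0) (h1 : g 1 = 0)
    (hC : ∀ t ∈ Icc (0 : ℝ) 1, |g₂ t| ≤ C) (k : ℕ) :
    |sineCoeff g (k + 1)| ≤ 2 * C * (1 / freq (k + 1) ^ 2) := by
  rw [sineCoeff_eq_of_zero hg hg₁ hg₂ h0 h1, abs_div, abs_neg, abs_of_nonneg (sq_nonneg (freq _)),
    div_eq_mul_one_div]
  gcongr
  exact abs_sineCoeff_le _ hC

theorem exists_sineCoeff_bound {α β : ℝ} {f : ℝ × ℝ → ℝ}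
    (hf : ContinuousOn f (Icc α β ×ˢ Icc (0 : ℝ) 1)) :
    ∃ C, 0 ≤ C ∧ ∀ k, ∀ s ∈ Icc α β, |sineCoeff (fun t => f (s, t)) k| ≤ C := by
  obtain ⟨C, hC⟩ := (isCompact_Icc.prod isCompact_Icc).exists_bound_of_continuousOn hf
  refine ⟨2 * max C 0, by positivity, fun k s hs => abs_sineCoeff_le k fun t ht => ?_⟩
  exact (hC (s, t) ⟨hs, ht⟩).trans (le_max_left _ _)

/-- The solution of `q'' = 1 - t`, `q(0) = q(1) = 0`. -/
noncomputable def bottomProfile (t : ℝ) : ℝ := t ^ 2 / 2 - t ^ 3 / 6 - t / 3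

/-- The solution of `q'' = t`, `q(0) = q(1) = 0`. -/
noncomputable def topProfile (t : ℝ) : ℝ := (t ^ 3 - t) / 6

theorem hasDerivAt_bottomProfile (t : ℝ) :
    HasDerivAt bottomProfile (t - t ^ 2 / 2 - 1 / 3) t := by
  have := (((hasDerivAt_pow 2 t).div_const 2).sub ((hasDerivAt_pow 3 t).div_const 6)).sub
    ((hasDerivAt_id t).div_const 3)
  refine this.congr_deriv ?_
  norm_num
  ring

theorem hasDerivAt_deriv_bottomProfile (t : ℝ) :
    HasDerivAt (fun t : ℝ => t - t ^ 2 / 2 - 1 / 3) (1 - t) t := by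
  have := ((hasDerivAt_id t).sub ((hasDerivAt_pow 2 t).div_const 2)).sub_const (1 / 3)
  refine this.congr_deriv ?_
  norm_num

theorem hasDerivAt_topProfile (t : ℝ) : HasDerivAt topProfile (t ^ 2 / 2 - 1 / 6) t := by
  have := ((hasDerivAt_pow 3 t).sub (hasDerivAt_id t)).div_const 6
  refine this.congr_deriv ?_
  norm_num
  ring

theorem hasDerivAt_deriv_topProfile (t : ℝ) :
    HasDerivAt (fun t : ℝ => t ^ 2 / 2 - 1 / 6) t t := by
  have := ((hasDerivAt_pow 2 t).div_const 2).sub_const (1 / 6)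
  refine this.congr_deriv ?_
  norm_num

theorem continuous_bottomProfile : Continuous bottomProfile :=
  continuous_iff_continuousAt.mpr fun t => (hasDerivAt_bottomProfile t).continuousAt

theorem continuous_topProfile : Continuous topProfile :=
  continuous_iff_continuousAt.mpr fun t => (hasDerivAt_topProfile t).continuousAt

theorem bottomProfile_zero : bottomProfile 0 = 0 := by norm_num [bottomProfile]
theorem bottomProfile_one : bottomProfile 1 = 0 := by norm_num [bottomProfile]
theorem topProfile_zero : topProfile 0 = 0 := by norm_num [topProfile]
theorem topProfile_one : topProfile 1 = 0 := by norm_num [topProfile]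

theorem sineCoeff_bottomProfile (k : ℕ) : sineCoeff (fun t => 1 - t) (k + 1)
    = -freq (k + 1) ^ 2 * sineCoeff bottomProfile (k + 1) := by
  have := (freq_succ_pos k).ne'
  rw [sineCoeff_eq_of_zero (fun t _ => (hasDerivAt_bottomProfile t).hasDerivWithinAt)
    (fun t _ => (hasDerivAt_deriv_bottomProfile t).hasDerivWithinAt) (by fun_prop)
    bottomProfile_zero bottomProfile_one]
  field_simp

theorem sineCoeff_topProfile (k : ℕ) : sineCoeff (fun t => t) (k + 1)
    = -freq (k + 1) ^ 2 * sineCoeff topProfile (k + 1) := by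
  have := (freq_succ_pos k).ne'
  rw [sineCoeff_eq_of_zero (fun t _ => (hasDerivAt_topProfile t).hasDerivWithinAt)
    (fun t _ => (hasDerivAt_deriv_topProfile t).hasDerivWithinAt) (by fun_prop)
    topProfile_zero topProfile_one]
  field_simp

theorem summable_abs_sineCoeff_bottomProfile :
    Summable fun k => |sineCoeff bottomProfile (k + 1)| :=
  Summable.of_nonneg_of_le (fun _ => abs_nonneg _)
    (abs_sineCoeff_le_of_zero (C := 1) (fun t _ => (hasDerivAt_bottomProfile t).hasDerivWithinAt)
      (fun t _ => (hasDerivAt_deriv_bottomProfile t).hasDerivWithinAt) (by fun_prop)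
      bottomProfile_zero bottomProfile_one
      fun t ht => abs_le.mpr ⟨by linarith [ht.2], by linarith [ht.1]⟩)
    (summable_inv_freq_sq.mul_left _)

theorem summable_abs_sineCoeff_topProfile :
    Summable fun k => |sineCoeff topProfile (k + 1)| :=
  Summable.of_nonneg_of_le (fun _ => abs_nonneg _)
    (abs_sineCoeff_le_of_zero (C := 1) (fun t _ => (hasDerivAt_topProfile t).hasDerivWithinAt)
      (fun t _ => (hasDerivAt_deriv_topProfile t).hasDerivWithinAt) (by fun_prop)
      topProfile_zero topProfile_one
      fun t ht => abs_le.mpr ⟨by linarith [ht.1], by linarith [ht.2]⟩)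
    (summable_inv_freq_sq.mul_left _)

/-- `a` is a sequence of solutions of the two-point problems for the sine coefficients of the
solution of Poisson's equation on `[α, β] × [0, 1]`, with summable boundary values. -/
structure IsModeFamily (α β : ℝ) (f : ℝ × ℝ → ℝ) (a a₁ : ℕ → ℝ → ℝ) : Prop where
  continuousOn : ∀ k, ContinuousOn (a k) (Icc α β)
  hasDerivAt : ∀ k, ∀ x ∈ Ioo α β, HasDerivAt (a k) (a₁ k x) x
  hasDerivAt_deriv : ∀ k, ∀ x ∈ Ioo α β, HasDerivAt (a₁ k)
    (freq (k + 1) ^ 2 * a k x + sineCoeff (fun t => f (x, t)) (k + 1)) x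
  summable_left : Summable fun k => |a k α|
  summable_right : Summable fun k => |a k β|

namespace IsModeFamily

variable {α β : ℝ} {f : ℝ × ℝ → ℝ} {a a₁ : ℕ → ℝ → ℝ}

/-- A majorant valid up to the vertical edges; it needs only bounded sine coefficients of `f` and
gives uniform convergence of the series. -/
theorem exists_summable_bound (h : IsModeFamily α β f a a₁)
    (hf : ContinuousOn f (Icc α β ×ˢ Icc (0 : ℝ) 1)) :
    ∃ M : ℕ → ℝ, Summable M ∧ ∀ k, ∀ x ∈ Icc α β, |a k x| ≤ M k := by
  obtain ⟨C, hC, hb⟩ := exists_sineCoeff_bound hf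
  refine ⟨fun k => |a k α| + |a k β| + C * (1 / freq (k + 1) ^ 2),
    (h.summable_left.add h.summable_right).add (summable_inv_freq_sq.mul_left C),
    fun k x hx => ?_⟩
  simp only [mul_one_div]
  exact abs_le_add_of_second_deriv_eq (freq_succ_pos k) (h.continuousOn k) (h.hasDerivAt k)
    (h.hasDerivAt_deriv k) hC (fun x hx => hb _ x (Ioo_subset_Icc_self hx)) hx

theorem abs_mul_sin_le {M : ℝ} {z y : ℝ} (h : |z| ≤ M) : |z * sin y| ≤ M := by
  rw [abs_mul]
  nlinarith [abs_nonneg z, abs_sin_le_one y, abs_nonneg (sin y)]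

theorem hasSum (h : IsModeFamily α β f a a₁)
    (hf : ContinuousOn f (Icc α β ×ˢ Icc (0 : ℝ) 1)) {x : ℝ} (hx : x ∈ Icc α β) (t : ℝ) :
    HasSum (fun k => a k x * sin (freq (k + 1) * t)) (∑' k, a k x * sin (freq (k + 1) * t)) := by
  obtain ⟨M, hM, hb⟩ := h.exists_summable_bound hf
  exact (Summable.of_norm_bounded hM fun k => abs_mul_sin_le (hb k x hx)).hasSum

theorem continuousOn_tsum (h : IsModeFamily α β f a a₁)
    (hf : ContinuousOn f (Icc α β ×ˢ Icc (0 : ℝ) 1)) :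
    ContinuousOn (fun x : ℝ × ℝ => ∑' k, a k x.1 * sin (freq (k + 1) * x.2))
      (Icc α β ×ˢ univ) := by
  obtain ⟨M, hM, hb⟩ := h.exists_summable_bound hf
  exact _root_.continuousOn_tsum
    (fun k => ((h.continuousOn k).comp continuousOn_fst fun x hx => hx.1).mul (by fun_prop)) hM
    fun k x hx => abs_mul_sin_le (hb k _ hx.1)

end IsModeFamily

end ContactData

/-! ### Interior regularity and Poisson's equation for the series. -/

namespace ContactData
namespace IsModeFamily

variable {α β : ℝ} {f : ℝ × ℝ → ℝ} {a a₁ : ℕ → ℝ → ℝ}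

/-- Series whose right-hand side has sine coefficients of order `1 / k²` are of class `C²`. -/
theorem exists_hasPlaneJetOn_of_bound {b b₁ g : ℕ → ℝ → ℝ} {K : ℝ} (hK : 0 ≤ K)
    (hc : ∀ k, ContinuousOn (b k) (Icc α β))
    (h₁ : ∀ k, ∀ x ∈ Ioo α β, HasDerivAt (b k) (b₁ k x) x)
    (h₂ : ∀ k, ∀ x ∈ Ioo α β, HasDerivAt (b₁ k) (freq (k + 1) ^ 2 * b k x + g k x) x)
    (hg : ∀ k, ContinuousOn (g k) (Ioo α β))
    (hgK : ∀ k, ∀ x ∈ Ioo α β, |g k x| ≤ K * (1 / freq (k + 1) ^ 2))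
    (hα : Summable fun k => |b k α|) (hβ : Summable fun k => |b k β|)
    {x : ℝ} (hx : x ∈ Ioo α β) :
    ∃ p q, x ∈ Ioo p q ∧ Ioo p q ⊆ Ioo α β ∧
    HasPlaneJetOn (Ioo p q ×ˢ univ) (fun x => ∑' k, b k x.1 * sin (freq (k + 1) * x.2))
      (fun x => ∑' k, b₁ k x.1 * sin (freq (k + 1) * x.2))
      (fun x => ∑' k, b k x.1 * (freq (k + 1) * cos (freq (k + 1) * x.2)))
      (fun x => ∑' k, (freq (k + 1) ^ 2 * b k x.1 + g k x.1) * sin (freq (k + 1) * x.2))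
      (fun x => ∑' k, b₁ k x.1 * (freq (k + 1) * cos (freq (k + 1) * x.2)))
      (fun x => ∑' k, b k x.1 * (-freq (k + 1) ^ 2 * sin (freq (k + 1) * x.2))) ∧
    ∀ y ∈ Ioo p q, ∀ t,
      Summable fun k => b k y * (-freq (k + 1) ^ 2 * sin (freq (k + 1) * t)) := by
  -- The margin on the right is wider so that for `y` in `(p, q)` the interval `[y, y + δ/ω]` stays
  -- in `[α + δ, β - δ]`.
  obtain ⟨δ, hδ, hδα, hδβ⟩ : ∃ δ > 0, α + 2 * δ ≤ x ∧ x ≤ β - 3 * δ := by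
    refine ⟨min (x - α) (β - x) / 4, ?_, ?_, ?_⟩
    · have := lt_min (sub_pos.mpr hx.1) (sub_pos.mpr hx.2); linarith
    · have := min_le_left (x - α) (β - x); have := hx.1; linarith
    · have := min_le_right (x - α) (β - x); have := hx.2; linarith
  set p := α + δ with hp
  set q := β - 2 * δ with hq
  set B : ℕ → ℝ := fun k => K * (1 / freq (k + 1) ^ 2) with hB
  have hB0 : ∀ k, 0 ≤ B k := fun k => by positivity
  set T : ℕ → ℝ := fun k => 2 / δ ^ 2 * (|b k α| + |b k β|) + B k with hT
  have hBT : ∀ k, B k ≤ T k := fun k => by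
    have : 0 ≤ 2 / δ ^ 2 * (|b k α| + |b k β|) := by positivity
    simp only [hT]; linarith
  have hT0 : ∀ k, 0 ≤ T k := fun k => (hB0 k).trans (hBT k)
  have hTs : Summable T := ((hα.add hβ).mul_left _).add (summable_inv_freq_sq.mul_left K)
  have bnd₀ : ∀ k, ∀ y ∈ Icc (α + δ) (β - δ), freq (k + 1) ^ 2 * |b k y| ≤ T k := fun k y hy =>
    sq_mul_abs_le_of_second_deriv_eq (freq_succ_pos k) hδ (hc k) (h₁ k) (h₂ k) (hB0 k) (hgK k) hy
  have hIcc : Icc (α + δ) (β - δ) ⊆ Ioo α β := fun y hy =>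
    ⟨by linarith [hy.1], by linarith [hy.2]⟩
  have bnd₂ : ∀ k, ∀ y ∈ Icc (α + δ) (β - δ),
      |freq (k + 1) ^ 2 * b k y + g k y| ≤ 2 * T k := fun k y hy => by
    refine (abs_add_le _ _).trans ?_
    rw [abs_mul, abs_of_nonneg (sq_nonneg (freq _))]
    have := bnd₀ k y hy
    have := hgK k y (hIcc hy)
    have := hBT k
    linarith
  have bnd₁ : ∀ k, ∀ y ∈ Ioo p q, freq (k + 1) * |b₁ k y| ≤ (2 / δ + 2 * δ) * T k :=
    fun k y hy => by
    have hω := freq_succ_pos k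
    set ω := freq (k + 1) with hωdef
    -- With this step both terms of the interpolation inequality are of order `T k / ω`.
    have hd : 0 < δ / ω := div_pos hδ hω
    have hdδ : δ / ω ≤ δ := div_le_self hδ.le (freq_succ_ge_one k)
    have hsub : Icc y (y + δ / ω) ⊆ Icc (α + δ) (β - δ) := fun z hz =>
      ⟨by linarith [hz.1, hy.1], by linarith [hz.2, hy.2]⟩
    have := abs_deriv_le_of_abs_le (A := T k / ω ^ 2) (B := 2 * T k) hd
      (fun z hz => h₁ k z (hIcc (hsub hz))) (fun z hz => h₂ k z (hIcc (hsub hz)))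
      (fun z hz => by
        rw [le_div_iff₀ (by positivity), mul_comm]
        exact bnd₀ k z (hsub hz))
      (fun z hz => bnd₂ k z (hsub hz))
    calc ω * |b₁ k y| ≤ ω * (2 * (T k / ω ^ 2) / (δ / ω) + δ / ω * (2 * T k)) := by gcongr
      _ = (2 / δ + 2 * δ) * T k := by field_simp
  have hpq : Ioo p q ⊆ Icc (α + δ) (β - δ) := fun y hy =>
    ⟨hy.1.le, by linarith [hy.2]⟩
  have hδ' : 0 < 2 / δ := by positivity
  refine ⟨p, q, ⟨by linarith, by linarith⟩, hpq.trans hIcc, ?_, ?_⟩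
  · refine hasPlaneJetOn_tsum_mul_sin (M := fun k => (2 + 2 / δ + 2 * δ) * T k) freq_succ_ge_one
      (hTs.mul_left _) (fun k y hy => h₁ k y (hIcc (hpq hy)))
      (fun k y hy => h₂ k y (hIcc (hpq hy))) (fun k => ?_) (fun k y hy => ?_) (fun k y hy => ?_)
      (fun k y hy => ?_)
    · exact (continuousOn_const.mul ((hc k).mono fun y hy =>
        Ioo_subset_Icc_self (hIcc (hpq hy)))).add ((hg k).mono (hpq.trans hIcc))
    · have := bnd₀ k y (hpq hy)
      nlinarith [hT0 k, mul_nonneg hδ'.le (hT0 k), mul_nonneg hδ.le (hT0 k)]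
    · have := bnd₁ k y hy
      nlinarith [hT0 k]
    · have := bnd₂ k y (hpq hy)
      nlinarith [hT0 k, mul_nonneg hδ'.le (hT0 k), mul_nonneg hδ.le (hT0 k)]
  · intro y hy t
    refine Summable.of_norm_bounded hTs fun k => ?_
    rw [norm_eq_abs, ← mul_assoc]
    refine abs_mul_sin_le ?_
    rw [abs_mul, abs_neg, abs_of_nonneg (sq_nonneg (freq _)), mul_comm]
    exact bnd₀ k y (hpq hy)

/-- The sine series with the modes `a` is a classical solution of Poisson's equation. -/
theorem exists_hasPlaneJetOn (hαβ : α < β) (h : IsModeFamily α β f a a₁)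
    (hf : ContDiffOn ℝ 2 f (Icc α β ×ˢ Icc (0 : ℝ) 1)) {x : ℝ × ℝ}
    (hx : x ∈ Ioo α β ×ˢ Ioo (0 : ℝ) 1) :
    ∃ u u₁ u₂ u₁₁ u₁₂ u₂₂ : ℝ × ℝ → ℝ, ∃ s : Set (ℝ × ℝ), IsOpen s ∧ x ∈ s ∧
      HasPlaneJetOn s u u₁ u₂ u₁₁ u₁₂ u₂₂ ∧ u₁₁ x + u₂₂ x = f x ∧
      (fun x : ℝ × ℝ => ∑' k, a k x.1 * sin (freq (k + 1) * x.2)) =ᶠ[nhds x] u := by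
  obtain ⟨f₁, f₂, f₁₁, f₂₂, c₁₁, c₂₂, hd⟩ := exists_second_partials_within hαβ hf
  have h0 : (0 : ℝ) ∈ Icc (0 : ℝ) 1 := ⟨le_rfl, zero_le_one⟩
  have h1 : (1 : ℝ) ∈ Icc (0 : ℝ) 1 := ⟨zero_le_one, le_rfl⟩
  have hIoo : Ioo α β ⊆ Icc α β := Ioo_subset_Icc_self
  have cfix : ∀ {F : ℝ × ℝ → ℝ}, ContinuousOn F (Icc α β ×ˢ Icc (0 : ℝ) 1) → ∀ t ∈ Icc (0 : ℝ) 1,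
      ContinuousOn (fun s => F (s, t)) (Icc α β) := fun hF t ht =>
    hF.comp (by fun_prop) fun s hs => ⟨hs, ht⟩
  have cfix' : ∀ {F : ℝ × ℝ → ℝ}, ContinuousOn F (Icc α β ×ˢ Icc (0 : ℝ) 1) → ∀ s ∈ Icc α β,
      ContinuousOn (fun t => F (s, t)) (Icc 0 1) := fun hF s hs =>
    hF.comp (by fun_prop) fun t ht => ⟨hs, ht⟩
  have dat : ∀ {F : ℝ → ℝ} {F' s : ℝ}, s ∈ Ioo α β → HasDerivWithinAt F F' (Icc α β) s →
      HasDerivAt F F' s := fun hs hF => hF.hasDerivAt (Icc_mem_nhds hs.1 hs.2)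
  set Q₀ : ℕ → ℝ := fun k => sineCoeff bottomProfile (k + 1) with hQ₀
  set Q₁ : ℕ → ℝ := fun k => sineCoeff topProfile (k + 1) with hQ₁
  -- The modes of the solution minus the corrector `f(s,0) bottomProfile + f(s,1) topProfile`.
  set b : ℕ → ℝ → ℝ := fun k s => a k s - (f (s, 0) * Q₀ k + f (s, 1) * Q₁ k) with hb
  set b₁ : ℕ → ℝ → ℝ := fun k s => a₁ k s - (f₁ (s, 0) * Q₀ k + f₁ (s, 1) * Q₁ k) with hb₁
  -- the right-hand side after subtraction of the corrector, and its derivatives in `t`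
  set G : ℝ → ℝ → ℝ := fun s t => f (s, t) + (-f (s, 0) * (1 - t) + -f (s, 1) * t)
    + (-f₁₁ (s, 0) * bottomProfile t + -f₁₁ (s, 1) * topProfile t) with hG
  set G₁ : ℝ → ℝ → ℝ := fun s t => f₂ (s, t) + (f (s, 0) - f (s, 1))
    + (-f₁₁ (s, 0) * (t - t ^ 2 / 2 - 1 / 3) + -f₁₁ (s, 1) * (t ^ 2 / 2 - 1 / 6)) with hG₁
  set G₂ : ℝ → ℝ → ℝ := fun s t => f₂₂ (s, t)
    + (-f₁₁ (s, 0) * (1 - t) + -f₁₁ (s, 1) * t) with hG₂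
  set g : ℕ → ℝ → ℝ := fun k s => sineCoeff (G s) (k + 1) with hg
  have dG : ∀ s ∈ Icc α β, ∀ t ∈ Icc (0 : ℝ) 1, HasDerivWithinAt (G s) (G₁ s t) (Icc 0 1) t := by
    intro s hs t ht
    have e₁ : HasDerivAt (fun t => -f (s, 0) * (1 - t) + -f (s, 1) * t) (f (s, 0) - f (s, 1)) t :=
      ((((hasDerivAt_id t).const_sub 1).const_mul (-f (s, 0))).add
        ((hasDerivAt_id t).const_mul (-f (s, 1)))).congr_deriv (by ring)
    exact (((hd s hs t ht).2.2.1).add e₁.hasDerivWithinAt).add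
      ((((hasDerivAt_bottomProfile t).const_mul _).add
        ((hasDerivAt_topProfile t).const_mul _)).hasDerivWithinAt)
  have dG₁ : ∀ s ∈ Icc α β, ∀ t ∈ Icc (0 : ℝ) 1,
      HasDerivWithinAt (G₁ s) (G₂ s t) (Icc 0 1) t := by
    intro s hs t ht
    exact (((hd s hs t ht).2.2.2).add_const _).add
      ((((hasDerivAt_deriv_bottomProfile t).const_mul _).add
        ((hasDerivAt_deriv_topProfile t).const_mul _)).hasDerivWithinAt)
  have cG₂ : ∀ s ∈ Icc α β, ContinuousOn (G₂ s) (Icc 0 1) := fun s hs =>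
    (cfix' c₂₂ s hs).add (by fun_prop)
  -- The second `t`-derivative of the corrector interpolates the edge values of `f` linearly, and
  -- its second `s`-derivative vanishes on the edges with the profiles.
  have G0 : ∀ s, G s 0 = 0 := fun s => by
    simp only [hG, bottomProfile_zero, topProfile_zero]; ring
  have G1 : ∀ s, G s 1 = 0 := fun s => by
    simp only [hG, bottomProfile_one, topProfile_one]; ring
  obtain ⟨K, hK0, hK⟩ : ∃ K, 0 ≤ K ∧ ∀ s ∈ Icc α β, ∀ t ∈ Icc (0 : ℝ) 1, |G₂ s t| ≤ K := by
    have hc : ContinuousOn (fun x : ℝ × ℝ => G₂ x.1 x.2) (Icc α β ×ˢ Icc (0 : ℝ) 1) := by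
      have k₀ : ContinuousOn (fun x : ℝ × ℝ => f₁₁ (x.1, 0)) (Icc α β ×ˢ Icc (0 : ℝ) 1) :=
        (cfix c₁₁ 0 h0).comp continuousOn_fst fun x hx => hx.1
      have k₁ : ContinuousOn (fun x : ℝ × ℝ => f₁₁ (x.1, 1)) (Icc α β ×ˢ Icc (0 : ℝ) 1) :=
        (cfix c₁₁ 1 h1).comp continuousOn_fst fun x hx => hx.1
      exact c₂₂.add ((k₀.neg.mul (by fun_prop)).add (k₁.neg.mul (by fun_prop)))
    obtain ⟨C, hC⟩ := (isCompact_Icc.prod isCompact_Icc).exists_bound_of_continuousOn hc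
    exact ⟨max C 0, le_max_right _ _, fun s hs t ht => (hC (s, t) ⟨hs, ht⟩).trans (le_max_left _ _)⟩
  have gK : ∀ k, ∀ s ∈ Icc α β, |g k s| ≤ 2 * K * (1 / freq (k + 1) ^ 2) := fun k s hs =>
    abs_sineCoeff_le_of_zero (dG s hs) (dG₁ s hs) (cG₂ s hs) (G0 s) (G1 s) (hK s hs) k
  have cbot := continuous_bottomProfile
  have ctop := continuous_topProfile
  have geq : ∀ k, ∀ s ∈ Icc α β, g k s = sineCoeff (fun t => f (s, t)) (k + 1)
      + freq (k + 1) ^ 2 * (f (s, 0) * Q₀ k + f (s, 1) * Q₁ k)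
      - (f₁₁ (s, 0) * Q₀ k + f₁₁ (s, 1) * Q₁ k) := by
    intro k s hs
    have cf := cfix' hf.continuousOn s hs
    simp only [hg, hG]
    rw [sineCoeff_add (g := fun t => f (s, t) + (-f (s, 0) * (1 - t) + -f (s, 1) * t))
        (h := fun t => -f₁₁ (s, 0) * bottomProfile t + -f₁₁ (s, 1) * topProfile t) _
        (cf.add (by fun_prop)) (by fun_prop),
      sineCoeff_add (g := fun t => f (s, t))
        (h := fun t => -f (s, 0) * (1 - t) + -f (s, 1) * t) _ cf (by fun_prop),
      sineCoeff_add (g := fun t => -f (s, 0) * (1 - t)) (h := fun t => -f (s, 1) * t) _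
        (by fun_prop) (by fun_prop),
      sineCoeff_add (g := fun t => -f₁₁ (s, 0) * bottomProfile t)
        (h := fun t => -f₁₁ (s, 1) * topProfile t) _ (by fun_prop) (by fun_prop),
      sineCoeff_const_mul, sineCoeff_const_mul, sineCoeff_const_mul, sineCoeff_const_mul,
      sineCoeff_bottomProfile, sineCoeff_topProfile]
    ring
  have d₁ : ∀ k, ∀ s ∈ Ioo α β, HasDerivAt (b k) (b₁ k s) s := fun k s hs =>
    (h.hasDerivAt k s hs).sub
      (((dat hs (hd s (hIoo hs) 0 h0).1).mul_const _).add
        ((dat hs (hd s (hIoo hs) 1 h1).1).mul_const _))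
  have d₂ : ∀ k, ∀ s ∈ Ioo α β, HasDerivAt (b₁ k) (freq (k + 1) ^ 2 * b k s + g k s) s := by
    intro k s hs
    refine ((h.hasDerivAt_deriv k s hs).sub
      (((dat hs (hd s (hIoo hs) 0 h0).2.1).mul_const _).add
        ((dat hs (hd s (hIoo hs) 1 h1).2.1).mul_const _))).congr_deriv ?_
    -- The factor `ω²` in `geq`, from the coefficients of `1 - t` and `t`, is what replaces `ω² a`
    -- by `ω² b`.
    rw [geq k s (hIoo hs)]
    simp only [hb]
    ring
  have cw : ∀ k, ContinuousOn (fun s => f (s, 0) * Q₀ k + f (s, 1) * Q₁ k) (Icc α β) := fun k =>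
    ((cfix hf.continuousOn 0 h0).mul continuousOn_const).add
      ((cfix hf.continuousOn 1 h1).mul continuousOn_const)
  have cg : ∀ k, ContinuousOn (g k) (Ioo α β) := by
    intro k
    refine ContinuousOn.mono (ContinuousOn.congr ?_ (geq k)) hIoo
    exact ((continuousOn_sineCoeff hαβ.le hf.continuousOn _).add (continuousOn_const.mul (cw k))).sub
      (((cfix c₁₁ 0 h0).mul continuousOn_const).add ((cfix c₁₁ 1 h1).mul continuousOn_const))
  have sQ₀ := summable_abs_sineCoeff_bottomProfile
  have sQ₁ := summable_abs_sineCoeff_topProfile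
  have sb : ∀ s, (Summable fun k => |a k s|) → Summable fun k => |b k s| := fun s hs =>
    (hs.of_abs.sub ((sQ₀.of_abs.mul_left (f (s, 0))).add (sQ₁.of_abs.mul_left (f (s, 1))))).abs
  obtain ⟨p, q, hxpq, hpq, hjet, hsum⟩ := exists_hasPlaneJetOn_of_bound (b := b)
    (b₁ := b₁) (g := g) (mul_nonneg two_pos.le hK0)
    (fun k => (h.continuousOn k).sub (cw k)) d₁ d₂ cg (fun k s hs => gK k s (hIoo hs))
    (sb α h.summable_left) (sb β h.summable_right) hx.1
  have jet : ∀ t₀ ∈ Icc (0 : ℝ) 1, ∀ e e₁ e₂ : ℝ → ℝ, (∀ t, HasDerivAt e (e₁ t) t) →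
      (∀ t, HasDerivAt e₁ (e₂ t) t) → Continuous e₂ → _ := fun t₀ ht₀ e e₁ e₂ he he₁ he₂ =>
    hasPlaneJetOn_mul (I := Ioo p q) (b := fun s => f (s, t₀)) (e := e)
      (fun s hs => dat (hpq hs) (hd s (hIoo (hpq hs)) t₀ ht₀).1)
      (fun s hs => dat (hpq hs) (hd s (hIoo (hpq hs)) t₀ ht₀).2.1)
      ((cfix c₁₁ t₀ ht₀).mono (hpq.trans hIoo)) he he₁ he₂
  have jet₀ := jet 0 h0 _ _ _ hasDerivAt_bottomProfile hasDerivAt_deriv_bottomProfile (by fun_prop)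
  have jet₁ := jet 1 h1 _ _ _ hasDerivAt_topProfile hasDerivAt_deriv_topProfile continuous_id
  refine ⟨_, _, _, _, _, _, Ioo p q ×ˢ univ, isOpen_Ioo.prod isOpen_univ, ⟨hxpq, mem_univ _⟩,
    hjet.add (jet₀.add jet₁), ?_, ?_⟩
  · have hxI : x.1 ∈ Icc α β := hIoo hx.1
    have hxt : x.2 ∈ Icc (0 : ℝ) 1 := Ioo_subset_Icc_self hx.2
    have hsG := hasSum_sineSeries (q := G x.1)
      (fun t ht => (dG x.1 hxI t ht).continuousWithinAt) (G0 _) (G1 _)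
      (Summable.of_norm_bounded (summable_inv_freq_sq.mul_left (2 * K)) fun k => gK k _ hxI) hxt
    have hs₂ := (hsum x.1 hxpq x.2).hasSum
    -- The `ω² b` terms of the two second derivatives cancel, leaving the sine series of `G`; the
    -- corrector restores `f`.
    have hs₁ : HasSum (fun k => (freq (k + 1) ^ 2 * b k x.1 + g k x.1)
        * sin (freq (k + 1) * x.2))
        (G x.1 x.2 - ∑' k, b k x.1 * (-freq (k + 1) ^ 2 * sin (freq (k + 1) * x.2))) := by
      refine (hsG.sub hs₂).congr_fun fun k => ?_
      simp only [hg]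
      ring
    rw [hs₁.tsum_eq]
    simp only [hG, Prod.mk.eta]
    ring
  · have hopen : IsOpen (Ioo α β ×ˢ Ioo (0 : ℝ) 1) := isOpen_Ioo.prod isOpen_Ioo
    filter_upwards [hopen.mem_nhds hx] with y hy
    have hyt : y.2 ∈ Icc (0 : ℝ) 1 := Ioo_subset_Icc_self hy.2
    have s₀ := (hasSum_sineSeries continuous_bottomProfile.continuousOn bottomProfile_zero
      bottomProfile_one sQ₀.of_abs hyt).mul_left (f (y.1, 0))
    have s₁ := (hasSum_sineSeries continuous_topProfile.continuousOn topProfile_zero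
      topProfile_one sQ₁.of_abs hyt).mul_left (f (y.1, 1))
    have sa := h.hasSum hf.continuousOn (hIoo hy.1) y.2
    have : HasSum (fun k => b k y.1 * sin (freq (k + 1) * y.2))
        ((∑' k, a k y.1 * sin (freq (k + 1) * y.2)) - (f (y.1, 0) * bottomProfile y.2
          + f (y.1, 1) * topProfile y.2)) := by
      refine (sa.sub (s₀.add s₁)).congr_fun fun k => ?_
      simp only [hb, hQ₀, hQ₁]
      ring
    rw [this.tsum_eq]
    ring

theorem contDiffOn_tsum (hαβ : α < β) (h : IsModeFamily α β f a a₁)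
    (hf : ContDiffOn ℝ 2 f (Icc α β ×ˢ Icc (0 : ℝ) 1)) :
    ContDiffOn ℝ 2 (fun x : ℝ × ℝ => ∑' k, a k x.1 * sin (freq (k + 1) * x.2))
      (Ioo α β ×ˢ Ioo (0 : ℝ) 1) := by
  intro x hx
  obtain ⟨u, _, _, _, _, _, s, hs, hxs, hj, _, hu⟩ := h.exists_hasPlaneJetOn hαβ hf hx
  exact (((hj.contDiffOn hs).contDiffAt (hs.mem_nhds hxs)).congr_of_eventuallyEq
    hu).contDiffWithinAt

theorem planeLaplacian_tsum (hαβ : α < β) (h : IsModeFamily α β f a a₁)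
    (hf : ContDiffOn ℝ 2 f (Icc α β ×ˢ Icc (0 : ℝ) 1)) {x : ℝ × ℝ}
    (hx : x ∈ Ioo α β ×ˢ Ioo (0 : ℝ) 1) :
    planeLaplacian (fun x : ℝ × ℝ => ∑' k, a k x.1 * sin (freq (k + 1) * x.2)) x = f x := by
  obtain ⟨u, _, _, _, _, _, s, hs, hxs, hj, hl, hu⟩ := h.exists_hasPlaneJetOn hαβ hf hx
  rw [planeLaplacian_congr hu, hj.planeLaplacian_eq hs hxs, hl]

end IsModeFamily
end ContactData

/-! ### Variation of constants and ratios of hyperbolic sines. -/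

/-- The variation of constants formula for `J'' = ω² J + c`, with continuous `c`. -/
theorem hasDerivAt_sinh_convolution {ω α : ℝ} (hω : ω ≠ 0) {c : ℝ → ℝ} (hc : Continuous c) (x : ℝ) :
    HasDerivAt (fun x => 1 / ω * ∫ s in α..x, sinh (ω * (x - s)) * c s)
      (∫ s in α..x, cosh (ω * (x - s)) * c s) x ∧
    HasDerivAt (fun x => ∫ s in α..x, cosh (ω * (x - s)) * c s)
      (ω ^ 2 * (1 / ω * ∫ s in α..x, sinh (ω * (x - s)) * c s) + c x) x := by
  set S : ℝ → ℝ := fun x => ∫ s in α..x, sinh (ω * s) * c s with hS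
  set C : ℝ → ℝ := fun x => ∫ s in α..x, cosh (ω * s) * c s with hC
  have cs : Continuous fun s => sinh (ω * s) * c s := by fun_prop
  have cc : Continuous fun s => cosh (ω * s) * c s := by fun_prop
  have dS : HasDerivAt S (sinh (ω * x) * c x) x := intervalIntegral.integral_hasDerivAt_right
    (cs.intervalIntegrable _ _) (cs.stronglyMeasurableAtFilter _ _) cs.continuousAt
  have dC : HasDerivAt C (cosh (ω * x) * c x) x := intervalIntegral.integral_hasDerivAt_right
    (cc.intervalIntegrable _ _) (cc.stronglyMeasurableAtFilter _ _) cc.continuousAt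
  -- The addition formulas take `x` out of the integrands, so that only the upper limits depend on
  -- it.
  have e₁ : ∀ x, ∫ s in α..x, sinh (ω * (x - s)) * c s
      = sinh (ω * x) * C x - cosh (ω * x) * S x := by
    intro x
    simp only [hS, hC]
    rw [← intervalIntegral.integral_const_mul, ← intervalIntegral.integral_const_mul,
      ← intervalIntegral.integral_sub ((cc.const_mul _).intervalIntegrable _ _)
        ((cs.const_mul _).intervalIntegrable _ _)]
    congr 1; funext s
    rw [mul_sub, sinh_sub]; ring
  have e₂ : ∀ x, ∫ s in α..x, cosh (ω * (x - s)) * c s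
      = cosh (ω * x) * C x - sinh (ω * x) * S x := by
    intro x
    simp only [hS, hC]
    rw [← intervalIntegral.integral_const_mul, ← intervalIntegral.integral_const_mul,
      ← intervalIntegral.integral_sub ((cc.const_mul _).intervalIntegrable _ _)
        ((cs.const_mul _).intervalIntegrable _ _)]
    congr 1; funext s
    rw [mul_sub, cosh_sub]; ring
  simp only [e₁, e₂]
  have dsinh : HasDerivAt (fun x => sinh (ω * x)) (cosh (ω * x) * ω) x := by
    simpa using ((hasDerivAt_id x).const_mul ω).sinh
  have dcosh : HasDerivAt (fun x => cosh (ω * x)) (sinh (ω * x) * ω) x := by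
    simpa using ((hasDerivAt_id x).const_mul ω).cosh
  constructor
  · refine (((dsinh.mul dC).sub (dcosh.mul dS)).const_mul (1 / ω)).congr_deriv ?_
    field_simp
    ring
  · refine ((dcosh.mul dC).sub (dsinh.mul dS)).congr_deriv ?_
    field_simp
    linear_combination (c x) * cosh_sq_sub_sinh_sq (ω * x)

/-- One form covering `am`, `ap` and both particular solutions. As `c` is continuous only on the
closed interval, it is replaced by its extension along the projection. -/
theorem exists_second_order_solution {ω α β A B p q : ℝ} (hαβ : α ≤ β) (hω : ω ≠ 0) {c a : ℝ → ℝ}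
    (hc : ContinuousOn c (Icc α β))
    (ha : ∀ x ∈ Icc α β, a x = A * sinh (ω * (x - p)) + B * sinh (ω * (x - q))
      + 1 / ω * ∫ s in α..x, sinh (ω * (x - s)) * c s) :
    ContinuousOn a (Icc α β) ∧ ∃ a₁ : ℝ → ℝ, (∀ x ∈ Ioo α β, HasDerivAt a (a₁ x) x) ∧
      ∀ x ∈ Ioo α β, HasDerivAt a₁ (ω ^ 2 * a x + c x) x := by
  set d : ℝ → ℝ := fun s => c (projIcc α β hαβ s) with hd
  have hdc : Continuous d := hc.comp_continuous
    (continuous_subtype_val.comp continuous_projIcc) fun x => Subtype.coe_prop _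
  have hdeq : ∀ x ∈ Icc α β, d x = c x := fun x hx => by simp [hd, projIcc_of_mem hαβ hx]
  set b : ℝ → ℝ := fun x => A * sinh (ω * (x - p)) + B * sinh (ω * (x - q))
      + 1 / ω * ∫ s in α..x, sinh (ω * (x - s)) * d s with hb
  have hab : EqOn a b (Icc α β) := fun x hx => by
    rw [ha x hx, hb]
    congr 2
    refine intervalIntegral.integral_congr fun s hs => ?_
    rw [uIcc_of_le hx.1] at hs
    simp only [hdeq s ⟨hs.1, hs.2.trans hx.2⟩]
  have ds : ∀ r x, HasDerivAt (fun x => sinh (ω * (x - r))) (ω * cosh (ω * (x - r))) x :=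
    fun r x => by simpa [mul_comm] using (((hasDerivAt_id x).sub_const r).const_mul ω).sinh
  have dc : ∀ r x, HasDerivAt (fun x => cosh (ω * (x - r))) (ω * sinh (ω * (x - r))) x :=
    fun r x => by simpa [mul_comm] using (((hasDerivAt_id x).sub_const r).const_mul ω).cosh
  have d₁ : ∀ x, HasDerivAt b (A * (ω * cosh (ω * (x - p))) + B * (ω * cosh (ω * (x - q)))
      + ∫ s in α..x, cosh (ω * (x - s)) * d s) x := fun x =>
    (((ds p x).const_mul A).add ((ds q x).const_mul B)).add (hasDerivAt_sinh_convolution hω hdc x).1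
  have hnear : ∀ x ∈ Ioo α β, a =ᶠ[nhds x] b := fun x hx => by
    filter_upwards [Icc_mem_nhds hx.1 hx.2] with y hy using hab hy
  refine ⟨ContinuousOn.congr (fun x _ => (d₁ x).continuousAt.continuousWithinAt) hab, _,
    fun x hx => (d₁ x).congr_of_eventuallyEq (hnear x hx), fun x hx => ?_⟩
  refine (((((dc p x).const_mul ω).const_mul A).add (((dc q x).const_mul ω).const_mul B)).add
    (hasDerivAt_sinh_convolution hω hdc x).2).congr_deriv ?_
  have hx' := Ioo_subset_Icc_self hx
  rw [hab hx', hb, hdeq x hx']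
  ring

/-- A convex function vanishing at `0` lies below its chord; here this follows from the comparison
principle for the difference. -/
theorem sinh_div_sinh_le {ω x L : ℝ} (hω : 0 < ω) (hx : 0 ≤ x) (hL : 0 < L) (hxL : x ≤ L) :
    sinh (ω * x) / sinh (ω * L) ≤ x / L := by
  have hs : 0 < sinh (ω * L) := sinh_pos_iff.mpr (by positivity)
  have ds : ∀ x, HasDerivAt (fun x => sinh (ω * x)) (ω * cosh (ω * x)) x :=
    fun x => by simpa [mul_comm] using ((hasDerivAt_id x).const_mul ω).sinh
  have dc : ∀ x, HasDerivAt (fun x => cosh (ω * x)) (ω * sinh (ω * x)) x :=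
    fun x => by simpa [mul_comm] using ((hasDerivAt_id x).const_mul ω).cosh
  have := nonneg_of_second_deriv_le (α := 0) (β := L) hω
    (c := fun x => x / L - sinh (ω * x) / sinh (ω * L))
    (c₁ := fun x => 1 / L - ω * cosh (ω * x) / sinh (ω * L))
    (c₂ := fun x => 0 - ω * (ω * sinh (ω * x)) / sinh (ω * L))
    (by fun_prop)
    (fun y _ => ((hasDerivAt_id y).div_const L).sub ((ds y).div_const _))
    (fun y _ => (hasDerivAt_const y _).sub (((dc y).const_mul ω).div_const _))
    (fun y hy => by
      have : 0 ≤ ω ^ 2 * (y / L) := mul_nonneg (sq_nonneg _) (div_nonneg hy.1.le hL.le)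
      have e : ω * (ω * sinh (ω * y)) / sinh (ω * L)
        = ω ^ 2 * (sinh (ω * y) / sinh (ω * L)) := by ring
      rw [e]
      linarith)
    (by simp) (by simp [div_self hL.ne', div_self hs.ne']) ⟨hx, hxL⟩
  linarith

/-! ### Summability of the trace coefficients and the explicit solution. -/

namespace ContactData

/-- The standing hypotheses on the data of the nonlocal contact problem. -/
structure Admissible (P : ContactData) : Prop where
  ξm_pos : 0 < P.ξm
  ξm_lt : P.ξm < P.ξ0
  lt_ξp : P.ξ0 < P.ξp
  ξp_lt : P.ξp < 1
  γm_pos : 0 < P.γm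
  γp_pos : 0 < P.γp
  γ_le : P.γm + P.γp ≤ 1
  contDiffOn_fm : ContDiffOn ℝ 2 P.fm (Icc 0 P.ξ0 ×ˢ Icc 0 1)
  contDiffOn_fp : ContDiffOn ℝ 2 P.fp (Icc P.ξ0 1 ×ˢ Icc 0 1)
  contDiffOn_φ0 : ContDiffOn ℝ 2 P.φ0 (Icc 0 1)
  φ0_zero : P.φ0 0 = 0
  φ0_one : P.φ0 1 = 0

/-- The left particular solution of the `k`-th mode equation with vanishing boundary values. -/
noncomputable def particularLeft (P : ContactData) (k : ℕ) (x : ℝ) : ℝ :=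
  P.Jm k x - P.Jm k P.ξ0 * sinh (freq k * x) / sinh (freq k * P.ξ0)

/-- The right particular solution of the `k`-th mode equation with vanishing boundary values. -/
noncomputable def particularRight (P : ContactData) (k : ℕ) (x : ℝ) : ℝ :=
  P.Jp k x - P.Jp k 1 * sinh (freq k * (x - P.ξ0)) / sinh (freq k * (1 - P.ξ0))

/-- The sum of the sine series, on the closed square. -/
noncomputable def seriesSolution (P : ContactData) (x : ℝ × ℝ) : ℝ :=
  if x.1 ≤ P.ξ0 then ∑' k, P.am (k + 1) x.1 * sin (freq (k + 1) * x.2)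
  else ∑' k, P.ap (k + 1) x.1 * sin (freq (k + 1) * x.2)

namespace Admissible

variable {P : ContactData}

theorem ξ0_pos (h : P.Admissible) : 0 < P.ξ0 := h.ξm_pos.trans h.ξm_lt

theorem ξ0_lt (h : P.Admissible) : P.ξ0 < 1 := h.lt_ξp.trans h.ξp_lt

theorem sinh_left_pos (h : P.Admissible) (k : ℕ) : 0 < sinh (freq (k + 1) * P.ξ0) :=
  sinh_pos_iff.mpr (mul_pos (freq_succ_pos k) h.ξ0_pos)

theorem sinh_right_pos (h : P.Admissible) (k : ℕ) : 0 < sinh (freq (k + 1) * (1 - P.ξ0)) :=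
  sinh_pos_iff.mpr (mul_pos (freq_succ_pos k) (sub_pos.mpr h.ξ0_lt))

theorem summable_sineCoeff_φ0 (h : P.Admissible) :
    Summable fun k => |sineCoeff P.φ0 (k + 1)| := by
  have hu : UniqueDiffOn ℝ (Icc (0 : ℝ) 1) := uniqueDiffOn_Icc zero_lt_one
  have c₁ : ContDiffOn ℝ 1 (derivWithin P.φ0 (Icc 0 1)) (Icc 0 1) :=
    h.contDiffOn_φ0.derivWithin hu (by norm_num)
  have c₂ : ContDiffOn ℝ 0 (derivWithin (derivWithin P.φ0 (Icc 0 1)) (Icc 0 1)) (Icc 0 1) :=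
    c₁.derivWithin hu (by norm_num)
  obtain ⟨C, hC⟩ := isCompact_Icc.exists_bound_of_continuousOn c₂.continuousOn
  exact Summable.of_nonneg_of_le (fun _ => abs_nonneg _)
    (abs_sineCoeff_le_of_zero
      (fun t ht => (h.contDiffOn_φ0.differentiableOn (by norm_num) t ht).hasDerivWithinAt)
      (fun t ht => (c₁.differentiableOn (by norm_num) t ht).hasDerivWithinAt) c₂.continuousOn
      h.φ0_zero h.φ0_one hC) (summable_inv_freq_sq.mul_left _)

/-- With zero boundary values only the term `K / ω²` of the estimate survives. The two terms of
`particularLeft` may each grow exponentially in `k`; only their difference is small. -/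
theorem particularLeft_bound (h : P.Admissible) : ∃ C, 0 ≤ C ∧ ∀ k, ∀ x ∈ Icc 0 P.ξ0,
    |P.particularLeft (k + 1) x| ≤ C * (1 / freq (k + 1) ^ 2) := by
  obtain ⟨C, hC, hb⟩ := exists_sineCoeff_bound h.contDiffOn_fm.continuousOn
  refine ⟨C, hC, fun k x hx => ?_⟩
  have hs := (h.sinh_left_pos k).ne'
  obtain ⟨hc, a₁, h₁, h₂⟩ := exists_second_order_solution (a := P.particularLeft (k + 1))
    (A := -(P.Jm (k + 1) P.ξ0 / sinh (freq (k + 1) * P.ξ0))) (B := 0) (p := 0) (q := 0)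
    h.ξ0_pos.le (freq_succ_pos k).ne'
    (continuousOn_sineCoeff h.ξ0_pos.le h.contDiffOn_fm.continuousOn (k + 1))
    fun x hx => by
      simp only [particularLeft, Jm, fmCoeff, sub_zero]
      ring
  have := abs_le_add_of_second_deriv_eq (freq_succ_pos k) hc h₁ h₂ hC
    (fun y hy => hb (k + 1) y (Ioo_subset_Icc_self hy)) hx
  have e₁ : P.particularLeft (k + 1) 0 = 0 := by simp [particularLeft, Jm]
  have e₂ : P.particularLeft (k + 1) P.ξ0 = 0 := by
    simp only [particularLeft]; field_simp; ring
  rw [e₁, e₂] at this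
  rw [mul_one_div]
  simpa using this

theorem particularRight_bound (h : P.Admissible) : ∃ C, 0 ≤ C ∧ ∀ k, ∀ x ∈ Icc P.ξ0 1,
    |P.particularRight (k + 1) x| ≤ C * (1 / freq (k + 1) ^ 2) := by
  obtain ⟨C, hC, hb⟩ := exists_sineCoeff_bound h.contDiffOn_fp.continuousOn
  refine ⟨C, hC, fun k x hx => ?_⟩
  have hs := (h.sinh_right_pos k).ne'
  obtain ⟨hc, a₁, h₁, h₂⟩ := exists_second_order_solution (a := P.particularRight (k + 1))
    (A := -(P.Jp (k + 1) 1 / sinh (freq (k + 1) * (1 - P.ξ0)))) (B := 0) (p := P.ξ0) (q := 0)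
    h.ξ0_lt.le (freq_succ_pos k).ne'
    (continuousOn_sineCoeff h.ξ0_lt.le h.contDiffOn_fp.continuousOn (k + 1))
    fun x hx => by
      simp only [particularRight, Jp, fpCoeff]
      ring
  have := abs_le_add_of_second_deriv_eq (freq_succ_pos k) hc h₁ h₂ hC
    (fun y hy => hb (k + 1) y (Ioo_subset_Icc_self hy)) hx
  have e₁ : P.particularRight (k + 1) P.ξ0 = 0 := by simp [particularRight, Jp]
  have e₂ : P.particularRight (k + 1) 1 = 0 := by
    simp only [particularRight]; field_simp; ring
  rw [e₁, e₂] at this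
  rw [mul_one_div]
  simpa using this

/-- Regroups `F` into particular solutions, where the exponentially large parts cancel. -/
theorem F_eq (P : ContactData) (k : ℕ) :
    -P.F k = P.γm * P.particularLeft k P.ξm + P.γp * P.particularRight k P.ξp := by
  simp only [F, rm, particularLeft, particularRight]
  ring

/-- A lower bound, uniform in `k`, for the denominator in the definition of `Φ`. -/
theorem exists_pos_le_denominator (h : P.Admissible) :
    ∃ d, 0 < d ∧ ∀ k, d ≤ 1 - (P.γm * P.rm (k + 1) + P.γp * P.rp (k + 1)) := by
  have h₀ := h.ξ0_pos
  have h₁ : 0 < 1 - P.ξ0 := sub_pos.mpr h.ξ0_lt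
  -- The ratios of hyperbolic sines are replaced by ratios of lengths, which do not depend on `k`
  -- and are less than `1`.
  refine ⟨1 - (P.γm * (P.ξm / P.ξ0) + P.γp * ((1 - P.ξp) / (1 - P.ξ0))), ?_, fun k => ?_⟩
  · have a₁ : P.ξm / P.ξ0 < 1 := (div_lt_one h₀).mpr h.ξm_lt
    have a₂ : (1 - P.ξp) / (1 - P.ξ0) < 1 := (div_lt_one h₁).mpr (by linarith [h.lt_ξp])
    have b₁ := mul_lt_mul_of_pos_left a₁ h.γm_pos
    have b₂ := mul_lt_mul_of_pos_left a₂ h.γp_pos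
    linarith [h.γ_le]
  · have a₁ : P.rm (k + 1) ≤ P.ξm / P.ξ0 :=
      sinh_div_sinh_le (freq_succ_pos k) h.ξm_pos.le h₀ h.ξm_lt.le
    have a₂ : P.rp (k + 1) ≤ (1 - P.ξp) / (1 - P.ξ0) :=
      sinh_div_sinh_le (freq_succ_pos k) (by linarith [h.ξp_lt]) h₁ (by linarith [h.lt_ξp])
    have b₁ := mul_le_mul_of_nonneg_left a₁ h.γm_pos.le
    have b₂ := mul_le_mul_of_nonneg_left a₂ h.γp_pos.le
    linarith

theorem summable_abs_Φ (h : P.Admissible) : Summable fun k => |P.Φ (k + 1)| := by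
  obtain ⟨d, hd, hD⟩ := h.exists_pos_le_denominator
  obtain ⟨C, hC, hL⟩ := h.particularLeft_bound
  obtain ⟨C', hC', hR⟩ := h.particularRight_bound
  refine Summable.of_nonneg_of_le (fun _ => abs_nonneg _) (fun k => ?_)
    (f := fun k => d⁻¹ * (P.γm * (C * (1 / freq (k + 1) ^ 2)) + P.γp * (C' * (1 / freq (k + 1) ^ 2))
      + |sineCoeff P.φ0 (k + 1)|)) ?_
  · have hpos := hd.trans_le (hD k)
    rw [Φ, F_eq, abs_mul, abs_inv, abs_of_pos hpos]
    have l := hL k P.ξm ⟨h.ξm_pos.le, h.ξm_lt.le⟩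
    have r := hR k P.ξp ⟨h.lt_ξp.le, h.ξp_lt.le⟩
    have i := hD k
    have g₁ := h.γm_pos
    have g₂ := h.γp_pos
    gcongr
    refine (abs_add_le _ _).trans (add_le_add_left ((abs_add_le _ _).trans ?_) _)
    rw [abs_mul, abs_mul, abs_of_pos g₁, abs_of_pos g₂]
    gcongr
  · have := summable_inv_freq_sq
    exact ((((this.mul_left C).mul_left P.γm).add ((this.mul_left C').mul_left P.γp)).add
      h.summable_sineCoeff_φ0).mul_left _

theorem am_ξ0 (h : P.Admissible) (k : ℕ) : P.am (k + 1) P.ξ0 = P.Φ (k + 1) := by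
  have := (h.sinh_left_pos k).ne'
  simp only [am]; field_simp; ring

theorem ap_ξ0 (h : P.Admissible) (k : ℕ) : P.ap (k + 1) P.ξ0 = P.Φ (k + 1) := by
  have := (h.sinh_right_pos k).ne'
  simp [ap, Jp, this]

theorem am_zero (P : ContactData) (k : ℕ) : P.am k 0 = 0 := by simp [am, Jm]

theorem ap_one (h : P.Admissible) (k : ℕ) : P.ap (k + 1) 1 = 0 := by
  have := (h.sinh_right_pos k).ne'
  simp only [ap, sub_self, mul_zero, sinh_zero]; field_simp; ring

/-- The contact condition for a single mode: each mode is `Φ` times a ratio of hyperbolic sines plus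
a particular solution, and solving for `Φ` gives its definition. -/
theorem Φ_eq (h : P.Admissible) (k : ℕ) : P.Φ (k + 1) = P.γm * P.am (k + 1) P.ξm
    + P.γp * P.ap (k + 1) P.ξp + sineCoeff P.φ0 (k + 1) := by
  obtain ⟨d, hd, hD⟩ := h.exists_pos_le_denominator
  have hpos := (hd.trans_le (hD k)).ne'
  have hΦ : (1 - (P.γm * P.rm (k + 1) + P.γp * P.rp (k + 1))) * P.Φ (k + 1)
      = P.γm * P.particularLeft (k + 1) P.ξm + P.γp * P.particularRight (k + 1) P.ξp
        + sineCoeff P.φ0 (k + 1) := by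
    rw [Φ, F_eq, mul_inv_cancel_left₀ hpos]
  have e₁ : P.am (k + 1) P.ξm = P.Φ (k + 1) * P.rm (k + 1) + P.particularLeft (k + 1) P.ξm := by
    simp only [am, rm, particularLeft]; ring
  have e₂ : P.ap (k + 1) P.ξp = P.Φ (k + 1) * P.rp (k + 1) + P.particularRight (k + 1) P.ξp := by
    simp only [ap, rp, particularRight]; ring
  rw [e₁, e₂]
  linear_combination hΦ

theorem exists_isModeFamily_left (h : P.Admissible) :
    ∃ a₁, IsModeFamily 0 P.ξ0 P.fm (fun k => P.am (k + 1)) a₁ := by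
  have key := fun k => exists_second_order_solution (a := P.am (k + 1))
    (A := (P.Φ (k + 1) - P.Jm (k + 1) P.ξ0) / sinh (freq (k + 1) * P.ξ0)) (B := 0) (p := 0) (q := 0)
    h.ξ0_pos.le (freq_succ_pos k).ne'
    (continuousOn_sineCoeff h.ξ0_pos.le h.contDiffOn_fm.continuousOn (k + 1))
    fun x hx => by
      simp only [am, Jm, fmCoeff, sub_zero]
      ring
  choose hc a₁ h₁ h₂ using key
  refine ⟨a₁, hc, h₁, h₂, ?_, ?_⟩
  · simp [am_zero]
  · simpa [h.am_ξ0] using h.summable_abs_Φ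

theorem exists_isModeFamily_right (h : P.Admissible) :
    ∃ a₁, IsModeFamily P.ξ0 1 P.fp (fun k => P.ap (k + 1)) a₁ := by
  have key := fun k => exists_second_order_solution (a := P.ap (k + 1))
    (A := -(P.Φ (k + 1) / sinh (freq (k + 1) * (1 - P.ξ0))))
    (B := -(P.Jp (k + 1) 1 / sinh (freq (k + 1) * (1 - P.ξ0)))) (p := 1) (q := P.ξ0)
    h.ξ0_lt.le (freq_succ_pos k).ne'
    (continuousOn_sineCoeff h.ξ0_lt.le h.contDiffOn_fp.continuousOn (k + 1))
    fun x hx => by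
      -- Oddness brings the term to the form `sinh (ω (x - p))` with `p = 1`, hence the sign in `A`.
      have : sinh (freq (k + 1) * (1 - x)) = -sinh (freq (k + 1) * (x - 1)) := by
        rw [← sinh_neg]; congr 1; ring
      simp only [ap, Jp, fpCoeff, this]
      ring
  choose hc a₁ h₁ h₂ using key
  refine ⟨a₁, hc, h₁, h₂, ?_, ?_⟩
  · simpa [h.ap_ξ0] using h.summable_abs_Φ
  · simp [h.ap_one]

theorem seriesSolution_left (P : ContactData) {x : ℝ × ℝ} (hx : x.1 ≤ P.ξ0) :
    P.seriesSolution x = ∑' k, P.am (k + 1) x.1 * sin (freq (k + 1) * x.2) := if_pos hx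

/-- On the contact line both series reduce to that of `Φ`, so the two branches glue. -/
theorem seriesSolution_right (h : P.Admissible) {x : ℝ × ℝ} (hx : P.ξ0 ≤ x.1) :
    P.seriesSolution x = ∑' k, P.ap (k + 1) x.1 * sin (freq (k + 1) * x.2) := by
  rcases hx.eq_or_lt with heq | hlt
  · rw [seriesSolution, if_pos heq.ge, ← heq]
    simp only [h.am_ξ0, h.ap_ξ0]
  · exact if_neg hlt.not_ge

theorem isSumOfSineSeries (h : P.Admissible) : P.IsSumOfSineSeries P.seriesSolution := by
  obtain ⟨_, hm⟩ := h.exists_isModeFamily_left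
  obtain ⟨_, hp⟩ := h.exists_isModeFamily_right
  have left : ∀ x₁ ∈ Icc 0 P.ξ0, ∀ x₂ ∈ Icc (0 : ℝ) 1,
      HasSum (fun k : ℕ => P.am (k + 1) x₁ * sin (freq (k + 1) * x₂))
        (P.seriesSolution (x₁, x₂)) := fun x₁ h₁ x₂ _ => by
    rw [seriesSolution_left P h₁.2]
    exact hm.hasSum h.contDiffOn_fm.continuousOn h₁ x₂
  refine ⟨left, fun x₂ h₂ => ?_, fun x₁ h₁ x₂ _ => ?_⟩
  · simpa only [h.am_ξ0] using left P.ξ0 ⟨h.ξ0_pos.le, le_rfl⟩ x₂ h₂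
  · rw [h.seriesSolution_right h₁.1]
    exact hp.hasSum h.contDiffOn_fp.continuousOn h₁ x₂

theorem continuousOn_seriesSolution (h : P.Admissible) :
    ContinuousOn P.seriesSolution closedSquare := by
  obtain ⟨_, hm⟩ := h.exists_isModeFamily_left
  obtain ⟨_, hp⟩ := h.exists_isModeFamily_right
  have cl : ContinuousOn P.seriesSolution (Icc 0 P.ξ0 ×ˢ univ) :=
    (hm.continuousOn_tsum h.contDiffOn_fm.continuousOn).congr
      fun x hx => seriesSolution_left P hx.1.2
  have cr : ContinuousOn P.seriesSolution (Icc P.ξ0 1 ×ˢ univ) :=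
    (hp.continuousOn_tsum h.contDiffOn_fp.continuousOn).congr
      fun x hx => h.seriesSolution_right hx.1.1
  refine (cl.union_of_isClosed cr (isClosed_Icc.prod isClosed_univ)
    (isClosed_Icc.prod isClosed_univ)).mono fun x hx => ?_
  rcases le_total x.1 P.ξ0 with h' | h'
  · exact Or.inl ⟨⟨hx.1.1, h'⟩, mem_univ _⟩
  · exact Or.inr ⟨⟨h', hx.1.2⟩, mem_univ _⟩

theorem isRegularSolution (h : P.Admissible) : P.IsRegularSolution P.seriesSolution := by
  obtain ⟨_, hm⟩ := h.exists_isModeFamily_left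
  obtain ⟨_, hp⟩ := h.exists_isModeFamily_right
  have hs := h.isSumOfSineSeries
  have eqm : EqOn P.seriesSolution
      (fun x => ∑' k, P.am (k + 1) x.1 * sin (freq (k + 1) * x.2)) P.Dm :=
    fun x hx => seriesSolution_left P hx.1.2.le
  have eqp : EqOn P.seriesSolution
      (fun x => ∑' k, P.ap (k + 1) x.1 * sin (freq (k + 1) * x.2)) P.Dp :=
    fun x hx => h.seriesSolution_right hx.1.1.le
  have oDm : IsOpen P.Dm := isOpen_Ioo.prod isOpen_Ioo
  have oDp : IsOpen P.Dp := isOpen_Ioo.prod isOpen_Ioo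
  exact
    { continuousOn := h.continuousOn_seriesSolution
      contDiffOn_left := (hm.contDiffOn_tsum h.ξ0_pos h.contDiffOn_fm).congr eqm
      contDiffOn_right := (hp.contDiffOn_tsum h.ξ0_lt h.contDiffOn_fp).congr eqp
      poisson_left := fun x hx => by
        rw [planeLaplacian_congr (eqm.eventuallyEq_of_mem (oDm.mem_nhds hx))]
        exact hm.planeLaplacian_tsum h.ξ0_pos h.contDiffOn_fm hx
      poisson_right := fun x hx => by
        rw [planeLaplacian_congr (eqp.eventuallyEq_of_mem (oDp.mem_nhds hx))]
        exact hp.planeLaplacian_tsum h.ξ0_lt h.contDiffOn_fp hx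
      zero_bottom := fun x₁ _ => by simp [seriesSolution]
      zero_top := fun x₁ _ => by simp [seriesSolution, sin_freq]
      zero_left := fun x₂ _ => by
        rw [seriesSolution_left P h.ξ0_pos.le]
        simp [am_zero]
      zero_right := fun x₂ _ => by
        rw [h.seriesSolution_right h.ξ0_lt.le]
        simp [h.ap_one]
      contact := fun x₂ h₂ => by
        have h₂' := Ioo_subset_Icc_self h₂
        have sφ := hasSum_sineSeries h.contDiffOn_φ0.continuousOn h.φ0_zero h.φ0_one
          h.summable_sineCoeff_φ0.of_abs h₂'
        have sm := hs.left P.ξm ⟨h.ξm_pos.le, h.ξm_lt.le⟩ x₂ h₂'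
        have sp := hs.right P.ξp ⟨h.lt_ξp.le, h.ξp_lt.le⟩ x₂ h₂'
        -- Both sides of the contact condition are sums of the same series, term by term by `Φ_eq`.
        refine (hs.middle x₂ h₂').unique ((((sm.mul_left P.γm).add (sp.mul_left P.γp)).add
          sφ).congr_fun fun k => ?_)
        rw [h.Φ_eq]
        ring }

end Admissible

end ContactData

theorem theorem1 (P : ContactData)
    (hξm : 0 < P.ξm) (hξm0 : P.ξm < P.ξ0) (hξ0p : P.ξ0 < P.ξp) (hξp : P.ξp < 1)
    (hγm : 0 < P.γm) (hγp : 0 < P.γp) (hγ : P.γm + P.γp ≤ 1)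
    (hfm : ContDiffOn ℝ 2 P.fm (Set.Icc 0 P.ξ0 ×ˢ Set.Icc 0 1))
    (hfp : ContDiffOn ℝ 2 P.fp (Set.Icc P.ξ0 1 ×ˢ Set.Icc 0 1))
    (hφ0 : ContDiffOn ℝ 2 P.φ0 (Set.Icc 0 1))
    (hφ0_zero : P.φ0 0 = 0) (hφ0_one : P.φ0 1 = 0) :
    ∃ u : ℝ × ℝ → ℝ, P.IsRegularSolution u ∧ P.IsSumOfSineSeries u ∧
      ∀ v : ℝ × ℝ → ℝ, P.IsRegularSolution v → Set.EqOn v u closedSquare := by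
  have h : P.Admissible :=
    ⟨hξm, hξm0, hξ0p, hξp, hγm, hγp, hγ, hfm, hfp, hφ0, hφ0_zero, hφ0_one⟩
  exact ⟨P.seriesSolution, h.isRegularSolution, h.isSumOfSineSeries, fun v hv =>
    h.isRegularSolution.eqOn hξm hξm0 hξ0p hξp hγm hγp hγ hv⟩
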